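/- Let $k$ be an algebraically closed field of characteristic $0$, let $X$ be a smooth connected affine curve over $k$, and let $\mathcal{E}=(E,\nabla)$ be a local system of rank $n$ on $X$, that is, a vector bundle $E$ of rank $n$ with a connection $\nabla\colon E\to E\otimes\omega_X$. Assume that $\mathcal{E}$ is irreducible: $E\neq 0$, and $0$ and $E$ are the only $\nabla$-stable sub-bundles of $E$ (a sub-bundle $F\prec E$ is a locally free subsheaf with locally free quotient $E/F$). For an affine $k$-scheme $S$ of finite type, a domain $U\Subset S\times X$ is an open subset that surjects onto $S$; write $\pi_U\colon U\to X$ for the projection, $E_U=\pi_U^*E$, and $\nabla_U\colon E_U\to E_U\otimes\pi_U^*\omega_X$ for the induced connection relative to $S$. For $1\le r\le n$ a partial oper of rank $r$ on $U$ is a flag of sub-bundles $0=F_0\prec F_1\prec\cdots\prec F_r\prec E_U$ with $\operatorname{rank}F_i=i$ such that $\nabla_U(F_i)\subset F_{i+1}\otimes\pi_U^*\omega_X$ for $0\le i\le r-1$ and such that the induced maps $F_{i+1}/F_i\to (F_{i+2}/F_{i+1})\otimes\pi_U^*\omega_X$ are isomorphisms for $0\le i\le r-2$. For $r=n$ one has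 $F_n=E_U$, and this is a $GL(n)$-oper on $U$. Let $\mathcal{P}^{[r]}_{\mathcal{E}}(S)$ be the colimit, over all domains $U\Subset S\times X$, of the sets of partial opers of rank $r$ on $U$, and let $\mathcal{L}_E(S)$ be the colimit over the same $U$ of the sets of sub-bundles of rank $1$ of $E_U$. By pull-back along morphisms $S'\to S$, these are presheaves of sets on the category of affine $k$-schemes of finite type; $\mathcal{P}_{\mathcal{E}}=\mathcal{P}^{[n]}_{\mathcal{E}}$ is the presheaf of generic $GL(n)$-opers and $\mathcal{L}_E$ is the presheaf of generic lines in $E$. Then: 1. for every $2\le r\le n-1$ the forgetful map $\mathcal{P}^{[r]}_{\mathcal{E}}\to\mathcal{P}^{[r-1]}_{\mathcal{E}}$, $(F_0,\dots,F_r)\mapsto(F_0,\dots,F_{r-1})$, is an isomorphism of presheaves; 2. for every $1\le r\le n$ the map $\mathcal{P}^{[r]}_{\mathcal{E}}\to\mathcal{L}_E$, $(F_0,\dots,F_r)\mapsto F_1$, is an isomorphism of presheaves. In particular ($r=n$) generic $GL(n)$-opers in $\mathcal{E}$ correspond to generic lines in $E$. -/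

import Mathlib

open TensorProduct KaehlerDifferential

universe u

noncomputable section

namespace GenericOper

/-- A local system for `GL` on the affine curve `X = Spec R` over `k`: the vector bundle is given
by the `R`-module `M`, and the connection is an additive map `∇ : M → ω_X ⊗ M` with
`∇ (a m) = a ∇ m + da ⊗ m`, where `ω_X = Ω[R⁄k]`. (`k`-linearity follows.) -/
structure Connection (k R M : Type*) [CommRing k] [CommRing R] [Algebra k R]
    [AddCommGroup M] [Module R M] where
  toFun : M →+ Ω[R⁄k] ⊗[R] M
  leibniz : ∀ (a : R) (m : M), toFun (a • m) = a • toFun m + D k R a ⊗ₜ[R] m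

/-- Irreducibility: the bundle is nonzero, and the only sub-bundles `P ≺ E` (submodules with
projective quotient) with `∇ P ⊆ ω_X ⊗ P` are `0` and `E`. -/
def Connection.IsIrreducible {k R M : Type*} [CommRing k] [CommRing R] [Algebra k R]
    [AddCommGroup M] [Module R M] (N : Connection k R M) : Prop :=
  Nontrivial M ∧ ∀ P : Submodule R M, Module.Projective R (M ⧸ P) →
    (∀ v ∈ P, N.toFun v ∈ LinearMap.range (P.subtype.lTensor Ω[R⁄k])) → P = ⊥ ∨ P = ⊤

/-! ### The pulled-back connection

`k → A → O` and `k → R → O` are ring maps; think of `Spec O → S × X` with `S = Spec A` and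
`X = Spec R`. Then `O ⊗[R] M` is the pull-back of `E`, and `Ω[O⁄A]` is the module of differentials
relative to `S`, which is the pull-back of `ω_X` when `O` is a local ring of `S × X`
(`isBaseChange_kaehler_stalk`). -/

section Algebra

variable {k R M : Type*} [CommRing k] [CommRing R] [Algebra k R] [AddCommGroup M] [Module R M]
variable (A O : Type*) [CommRing A] [CommRing O] [Algebra k A] [Algebra k O] [Algebra A O]
  [Algebra R O] [IsScalarTower k A O] [IsScalarTower k R O]

/-- The pull-back map `ω_X ⊗ M → Ω[O⁄A] ⊗ (O ⊗ M)`. -/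
def twistPull : Ω[R⁄k] ⊗[R] M →ₗ[R] Ω[O⁄A] ⊗[O] (O ⊗[R] M) :=
  TensorProduct.lift
    (((TensorProduct.mk O Ω[O⁄A] (O ⊗[R] M)).restrictScalars₁₂ R R).compl₁₂
      (KaehlerDifferential.map k A R O) (TensorProduct.mk R O M 1))

@[simp]
theorem twistPull_tmul (w : Ω[R⁄k]) (m : M) :
    twistPull A O (w ⊗ₜ[R] m) =
      KaehlerDifferential.map k A R O w ⊗ₜ[O] ((1 : O) ⊗ₜ[R] m) := rfl

/-- The pulled-back connection, relative to `A`: `f ⊗ m ↦ f ∇ m + df ⊗ (1 ⊗ m)`. -/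
def Connection.pull (N : Connection k R M) :
    O ⊗[R] M →+ Ω[O⁄A] ⊗[O] (O ⊗[R] M) :=
  TensorProduct.liftAddHom
    (AddMonoidHom.mk' (fun f => AddMonoidHom.mk'
        (fun m => f • twistPull A O (N.toFun m) + D A O f ⊗ₜ[O] ((1 : O) ⊗ₜ[R] m))
        (fun m m' => by simp only [map_add, smul_add, TensorProduct.tmul_add]; abel))
      (fun f f' => by
        ext m
        simp only [map_add, add_smul, TensorProduct.add_tmul, AddMonoidHom.mk'_apply,
          AddMonoidHom.add_apply]
        abel))
    (fun a f m => by
      have h : (1 : O) ⊗ₜ[R] (a • m) = algebraMap R O a • ((1 : O) ⊗ₜ[R] m) := by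
        rw [TensorProduct.tmul_smul, algebraMap_smul]
      simp only [AddMonoidHom.mk'_apply, N.leibniz, map_add, map_smul, twistPull_tmul,
        KaehlerDifferential.map_D, smul_add, h, Algebra.smul_def a f, Derivation.leibniz,
        TensorProduct.add_tmul, TensorProduct.tmul_smul, mul_smul, algebraMap_smul,
        ← TensorProduct.smul_tmul']
      rw [smul_comm a f]
      abel)

variable {O}

@[simp]
theorem Connection.pull_tmul (N : Connection k R M) (f : O) (m : M) :
    N.pull A O (f ⊗ₜ[R] m) =
      f • twistPull A O (N.toFun m) + D A O f ⊗ₜ[O] ((1 : O) ⊗ₜ[R] m) := rfl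

theorem Connection.pull_smul (N : Connection k R M) (f : O) (x : O ⊗[R] M) :
    N.pull A O (f • x) = f • N.pull A O x + D A O f ⊗ₜ[O] x := by
  induction x with
  | zero => simp
  | tmul g m =>
    have h : D A O f ⊗ₜ[O] (g ⊗ₜ[R] m) = g • (D A O f ⊗ₜ[O] ((1 : O) ⊗ₜ[R] m)) := by
      rw [← TensorProduct.tmul_smul, TensorProduct.smul_tmul', smul_eq_mul, mul_one]
    rw [TensorProduct.smul_tmul', smul_eq_mul, h]
    simp only [Connection.pull_tmul, Derivation.leibniz, mul_smul, smul_add,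
      TensorProduct.add_tmul, ← TensorProduct.smul_tmul']
    abel
  | add x y hx hy => simp only [smul_add, map_add, hx, hy, TensorProduct.tmul_add]; abel

/-- `ω ⊗ Q` as a submodule of `ω ⊗ E`. -/
def twist (Q : Submodule O (O ⊗[R] M)) : Submodule O (Ω[O⁄A] ⊗[O] (O ⊗[R] M)) :=
  LinearMap.range (Q.subtype.lTensor Ω[O⁄A])


theorem tmul_mem_twist {Q : Submodule O (O ⊗[R] M)} (w : Ω[O⁄A]) {x : O ⊗[R] M} (hx : x ∈ Q) :
    w ⊗ₜ[O] x ∈ twist A Q := ⟨w ⊗ₜ[O] ⟨x, hx⟩, rfl⟩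

theorem twist_le {Q : Submodule O (O ⊗[R] M)} {L : Submodule O (Ω[O⁄A] ⊗[O] (O ⊗[R] M))}
    (h : ∀ (w : Ω[O⁄A]) (x : O ⊗[R] M), x ∈ Q → w ⊗ₜ[O] x ∈ L) : twist A Q ≤ L := by
  rintro _ ⟨z, rfl⟩
  induction z with
  | zero => simp
  | tmul w x => exact h w x x.2
  | add x y hx hy => rw [map_add]; exact L.add_mem hx hy

/-- `∇` restricts to a map `P → ω ⊗ Q`. -/
def Connection.MapsInto (N : Connection k R M) (P Q : Submodule O (O ⊗[R] M)) : Prop :=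
  ∀ v ∈ P, N.pull A O v ∈ twist A Q

/-- For `P ⊆ Q ⊆ T` with `∇ P ⊆ ω ⊗ Q` and `∇ Q ⊆ ω ⊗ T`: the induced map
`Q / P → ω ⊗ (T / Q) = (ω ⊗ T) / (ω ⊗ Q)` is injective and surjective. -/
def Connection.GrBijective (N : Connection k R M) (P Q T : Submodule O (O ⊗[R] M)) : Prop :=
  (∀ v ∈ Q, N.pull A O v ∈ twist A Q → v ∈ P) ∧
    ∀ w ∈ twist A T, ∃ v ∈ Q, w - N.pull A O v ∈ twist A Q

end Algebra

section BaseChange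

variable {k R M : Type*} [CommRing k] [CommRing R] [Algebra k R] [AddCommGroup M] [Module R M]

/-- The map `O ⊗ M → O' ⊗ M` induced by `θ : O → O'`. -/
def eMap {O O' : Type*} [CommRing O] [CommRing O'] [Algebra R O] [Algebra R O']
    (θ : O →ₐ[R] O') : O ⊗[R] M →ₗ[R] O' ⊗[R] M := θ.toLinearMap.rTensor M

/-- The pull-back of a submodule of `O ⊗ M` to `O' ⊗ M`: the `O'`-span of its image. -/
def spanMap {O O' : Type*} [CommRing O] [CommRing O'] [Algebra R O] [Algebra R O']
    (θ : O →ₐ[R] O') (P : Submodule O (O ⊗[R] M)) : Submodule O' (O' ⊗[R] M) :=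
  Submodule.span O' (eMap θ '' P)

theorem eMap_smul {O O' : Type*} [CommRing O] [CommRing O'] [Algebra R O] [Algebra R O']
    (θ : O →ₐ[R] O') (c : O) (x : O ⊗[R] M) : eMap θ (c • x) = θ c • eMap θ x := by
  induction x with
  | zero => simp
  | tmul f m => simp [eMap, TensorProduct.smul_tmul']
  | add x y hx hy => simp only [smul_add, map_add, hx, hy]

theorem spanMap_id {O : Type*} [CommRing O] [Algebra R O] (P : Submodule O (O ⊗[R] M)) :
    spanMap (AlgHom.id R O) P = P := by
  have : (eMap (AlgHom.id R O) : O ⊗[R] M →ₗ[R] O ⊗[R] M) = LinearMap.id := by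
    simp [eMap]
  simp [spanMap, this]

theorem spanMap_span {O O' : Type*} [CommRing O] [CommRing O'] [Algebra R O] [Algebra R O']
    (θ : O →ₐ[R] O') (s : Set (O ⊗[R] M)) :
    spanMap θ (Submodule.span O s) = Submodule.span O' (eMap θ '' s) := by
  apply le_antisymm
  · refine Submodule.span_le.2 ?_
    rintro _ ⟨x, hx, rfl⟩
    induction hx using Submodule.span_induction with
    | mem x h => exact Submodule.subset_span ⟨x, h, rfl⟩
    | zero => simp
    | add x y _ _ hx hy => rw [map_add]; exact add_mem hx hy
    | smul c x _ hx => rw [eMap_smul]; exact Submodule.smul_mem _ _ hx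
  · exact Submodule.span_mono (Set.image_mono Submodule.subset_span)

theorem spanMap_comp {O O' O'' : Type*} [CommRing O] [CommRing O'] [CommRing O''] [Algebra R O]
    [Algebra R O'] [Algebra R O''] (θ : O →ₐ[R] O') (θ' : O' →ₐ[R] O'')
    (P : Submodule O (O ⊗[R] M)) :
    spanMap (θ'.comp θ) P = spanMap θ' (spanMap θ P) := by
  conv_rhs => rw [spanMap, spanMap.eq_1 θ]
  change _ = spanMap θ' (Submodule.span O' _)
  rw [spanMap_span, ← Set.image_comp, spanMap]
  congr 2
  ext x
  simp [eMap, LinearMap.rTensor_comp]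

variable (A O A' O' : Type*) [CommRing A] [CommRing O] [CommRing A'] [CommRing O']
  [Algebra k A] [Algebra k O] [Algebra A O] [Algebra R O] [IsScalarTower k A O]
  [IsScalarTower k R O] [Algebra k A'] [Algebra k O'] [Algebra A' O'] [Algebra R O']
  [IsScalarTower k A' O'] [IsScalarTower k R O'] [Algebra A A'] [Algebra O O'] [Algebra A O']
  [IsScalarTower A O O'] [IsScalarTower A A' O'] [IsScalarTower R O O']

/-- `eMap` as an `O`-linear map. -/
def eMapO : O ⊗[R] M →ₗ[O] O' ⊗[R] M :=
  AlgebraTensorModule.map (Algebra.linearMap O O') LinearMap.id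

theorem eMapO_apply (x : O ⊗[R] M) :
    eMapO O O' x = eMap (IsScalarTower.toAlgHom R O O') x := by
  induction x with
  | zero => simp
  | tmul f m => simp [eMap, eMapO]
  | add x y hx hy => simp only [map_add, hx, hy]

theorem isBaseChange_eMapO : IsBaseChange O' (eMapO O O' : O ⊗[R] M →ₗ[O] O' ⊗[R] M) := by
  refine IsBaseChange.of_comp (TensorProduct.isBaseChange R M O) ?_
  convert TensorProduct.isBaseChange R M O' using 1
  ext m
  simp [eMapO]

/-- The map `ω ⊗ E → ω' ⊗ E'` induced by base change. -/
def tMap : Ω[O⁄A] ⊗[O] (O ⊗[R] M) →ₗ[O] Ω[O'⁄A'] ⊗[O'] (O' ⊗[R] M) :=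
  TensorProduct.lift
    (((TensorProduct.mk O' Ω[O'⁄A'] (O' ⊗[R] M)).restrictScalars₁₂ O O).compl₁₂
      (KaehlerDifferential.map A A' O O') (eMapO O O'))

@[simp]
theorem tMap_tmul (w : Ω[O⁄A]) (x : O ⊗[R] M) :
    tMap A O A' O' (w ⊗ₜ[O] x) = KaehlerDifferential.map A A' O O' w ⊗ₜ[O'] eMapO O O' x := rfl

theorem kaehler_map_map (w : Ω[R⁄k]) :
    KaehlerDifferential.map A A' O O' (KaehlerDifferential.map k A R O w) =
      KaehlerDifferential.map k A' R O' w := by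
  have hw : w ∈ Submodule.span R (Set.range (D k R)) := by
    rw [KaehlerDifferential.span_range_derivation]; trivial
  induction hw using Submodule.span_induction with
  | mem w h =>
    obtain ⟨a, rfl⟩ := h
    simp [← IsScalarTower.algebraMap_apply]
  | zero => simp
  | add x y _ _ hx hy => simp only [map_add, hx, hy]
  | smul c x _ hx =>
    rw [map_smul, ← algebraMap_smul O c, map_smul, hx, map_smul, algebraMap_smul]

theorem tMap_twistPull (z : Ω[R⁄k] ⊗[R] M) :
    tMap A O A' O' (twistPull A O z) = twistPull A' O' z := by
  induction z with
  | zero => simp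
  | tmul w m => simp [kaehler_map_map, eMapO]
  | add x y hx hy => simp only [map_add, hx, hy]

theorem tMap_pull (N : Connection k R M) (x : O ⊗[R] M) :
    tMap A O A' O' (N.pull A O x) = N.pull A' O' (eMapO O O' x) := by
  induction x with
  | zero => simp
  | tmul f m =>
    have : eMapO O O' (f ⊗ₜ[R] m) = algebraMap O O' f ⊗ₜ[R] m := by simp [eMapO]
    rw [this]
    simp [tMap_twistPull, eMapO, algebraMap_smul]
  | add x y hx hy => simp only [map_add, hx, hy]


theorem eMapO_mem {P : Submodule O (O ⊗[R] M)} {x : O ⊗[R] M} (hx : x ∈ P) :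
    eMapO O O' x ∈ spanMap (IsScalarTower.toAlgHom R O O') P :=
  Submodule.subset_span ⟨x, hx, (eMapO_apply O O' x).symm⟩

theorem spanMap_induction {P : Submodule O (O ⊗[R] M)} {L : Submodule O' (O' ⊗[R] M)}
    (h : ∀ x ∈ P, eMapO O O' x ∈ L) : spanMap (IsScalarTower.toAlgHom R O O') P ≤ L := by
  refine Submodule.span_le.2 ?_
  rintro _ ⟨x, hx, rfl⟩
  rw [← eMapO_apply]
  exact h x hx

theorem tMap_mem_twist {Q : Submodule O (O ⊗[R] M)} {z : Ω[O⁄A] ⊗[O] (O ⊗[R] M)}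
    (hz : z ∈ twist A Q) :
    tMap A O A' O' z ∈ twist A' (spanMap (IsScalarTower.toAlgHom R O O') Q) := by
  obtain ⟨z, rfl⟩ := hz
  induction z with
  | zero => simp
  | tmul w x => exact tmul_mem_twist _ _ (eMapO_mem O O' x.2)
  | add x y hx hy => simp only [map_add]; exact add_mem hx hy

theorem mapsInto_baseChange (N : Connection k R M) {P Q : Submodule O (O ⊗[R] M)} (hPQ : P ≤ Q)
    (h : N.MapsInto A P Q) :
    N.MapsInto A' (spanMap (IsScalarTower.toAlgHom R O O') P)
      (spanMap (IsScalarTower.toAlgHom R O O') Q) := by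
  have hle : spanMap (IsScalarTower.toAlgHom R O O') P ≤
      spanMap (IsScalarTower.toAlgHom R O O') Q := Submodule.span_mono (Set.image_mono hPQ)
  intro v hv
  refine Submodule.span_induction (p := fun v _ => N.pull A' O' v ∈ twist A' _) ?_ ?_ ?_ ?_ hv
  · rintro _ ⟨x, hx, rfl⟩
    rw [← eMapO_apply, ← tMap_pull A O A' O']
    exact tMap_mem_twist _ _ _ _ (h x hx)
  · simp
  · intro x y _ _ hx hy
    rw [map_add]; exact add_mem hx hy
  · intro c x hx' hx
    rw [Connection.pull_smul]
    exact add_mem (Submodule.smul_mem _ _ hx) (tmul_mem_twist _ _ (hle hx'))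

/-- `P` is spanned by the first `i` vectors of some finite basis. -/
def IsFramed {O E : Type*} [CommRing O] [AddCommGroup E] [Module O E] (i : ℕ)
    (P : Submodule O E) : Prop :=
  ∃ (j : ℕ) (b : Module.Basis (Fin i ⊕ Fin j) O E),
    P = Submodule.span O (Set.range fun x => b (Sum.inl x))

theorem IsFramed.split {O E : Type*} [CommRing O] [AddCommGroup E] [Module O E] {i : ℕ}
    {P : Submodule O E} (h : IsFramed i P) :
    (∃ C, IsCompl P C) ∧ Module.Finite O P ∧ Module.Free O P ∧
      (Nontrivial O → Module.finrank O P = i) := by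
  obtain ⟨j, b, rfl⟩ := h
  have hli : LinearIndependent O (fun x => b (Sum.inl x)) :=
    b.linearIndependent.comp _ Sum.inl_injective
  refine ⟨⟨Submodule.span O (Set.range fun x => b (Sum.inr x)), ?_⟩, ?_, ?_, ?_⟩
  · constructor
    · have := b.linearIndependent.disjoint_span_image (s := Set.range Sum.inl)
        (t := Set.range Sum.inr) Set.isCompl_range_inl_range_inr.disjoint
      rwa [← Set.range_comp, ← Set.range_comp] at this
    · rw [codisjoint_iff, ← Submodule.span_union, ← b.span_eq]
      congr 1
      ext x
      simp
  · exact Module.Finite.span_of_finite O (Set.finite_range _)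
  · exact Module.Free.of_basis (Module.Basis.span hli)
  · intro _
    rw [Module.finrank_eq_card_basis (Module.Basis.span hli), Fintype.card_fin]

theorem IsFramed.exists_generator {O E : Type*} [CommRing O] [IsLocalRing O] [AddCommGroup E]
    [Module O E] {i : ℕ} {P Q : Submodule O E} (hP : IsFramed i P) (hQ : IsFramed (i + 1) Q)
    (h : P ≤ Q) :
    ∃ e ∈ Q, ∃ s : E →ₗ[O] O, (∀ x ∈ P, s x = 0) ∧ s e = 1 ∧ ∀ x ∈ Q, x - s x • e ∈ P := by
  obtain ⟨⟨C, hC⟩, _, _, hPi⟩ := hP.split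
  obtain ⟨⟨C', hC'⟩, _, _, hQi⟩ := hQ.split
  let P₀ : Submodule O Q := P.submoduleOf Q
  let C₀ : Submodule O Q := C.submoduleOf Q
  have hc : IsCompl P₀ C₀ := by
    constructor
    · rw [Submodule.disjoint_def]
      intro x hx hx'
      exact Subtype.ext (Submodule.disjoint_def.1 hC.disjoint _ hx hx')
    · rw [codisjoint_iff, eq_top_iff]
      rintro x -
      obtain ⟨y, hy, z, hz, hyz⟩ := Submodule.mem_sup.1
        (show (x : E) ∈ P ⊔ C from hC.sup_eq_top ▸ Submodule.mem_top)
      have hzQ : z ∈ Q := by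
        have : z = x - y := by rw [← hyz]; abel
        rw [this]; exact sub_mem x.2 (h hy)
      exact Submodule.mem_sup.2 ⟨⟨y, h hy⟩, hy, ⟨z, hzQ⟩, hz, Subtype.ext hyz⟩
  let ePC := Submodule.prodEquivOfIsCompl P₀ C₀ hc
  have eP : P₀ ≃ₗ[O] P := Submodule.submoduleOfEquivOfLe h
  have hfin : Module.Finite O C₀ :=
    Module.Finite.of_surjective (Submodule.projectionOnto C₀ P₀ hc.symm)
      (Submodule.projectionOnto_surjective hc.symm)
  have hproj : Module.Projective O C₀ :=
    Module.Projective.of_split C₀.subtype (Submodule.projectionOnto C₀ P₀ hc.symm)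
      (by ext x; simp)
  have hfree : Module.Free O C₀ := Module.free_of_flat_of_isLocalRing
  have : Module.Free O P₀ := Module.Free.of_equiv eP.symm
  have : Module.Finite O P₀ := Module.Finite.equiv eP.symm
  have hr : Module.finrank O C₀ = 1 := by
    have h1 := ePC.finrank_eq
    rw [Module.finrank_prod, eP.finrank_eq, hPi inferInstance, hQi inferInstance] at h1
    omega
  let b : Module.Basis Unit O C₀ := Module.basisUnique Unit hr
  let s : E →ₗ[O] O := (b.coord ()) ∘ₗ (Submodule.projectionOnto C₀ P₀ hc.symm) ∘ₗ
    (Submodule.projectionOnto Q C' hC')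
  refine ⟨(b () : C₀), (b () : C₀).1.2, s, ?_, ?_, ?_⟩
  · intro x hx
    have : Submodule.projectionOnto Q C' hC' x = ⟨x, h hx⟩ :=
      Submodule.projectionOnto_apply_left hC' ⟨x, h hx⟩
    simp only [s, LinearMap.comp_apply, this]
    rw [(Submodule.projectionOnto_apply_eq_zero_iff hc.symm).2
      (show (⟨x, h hx⟩ : Q) ∈ P₀ from hx), map_zero]
  · have : Submodule.projectionOnto Q C' hC' ((b () : C₀) : Q) = ((b () : C₀) : Q) :=
      Submodule.projectionOnto_apply_left hC' _
    simp only [s, LinearMap.comp_apply, this]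
    rw [Submodule.projectionOnto_apply_left hc.symm]
    simp
  · intro x hx
    have hxQ : Submodule.projectionOnto Q C' hC' x = ⟨x, hx⟩ :=
      Submodule.projectionOnto_apply_left hC' ⟨x, hx⟩
    set y := Submodule.projectionOnto C₀ P₀ hc.symm ⟨x, hx⟩ with hy
    have hsx : s x • b () = y := by
      have := b.sum_repr y
      simpa [s, hxQ, ← hy] using this
    have hmem : (⟨x, hx⟩ : Q) - y ∈ P₀ := by
      rw [← Submodule.ker_projectionOnto hc.symm, LinearMap.mem_ker, map_sub,
        Submodule.projectionOnto_apply_left, ← hy, sub_self]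
    have hcoe : x - s x • ((b () : C₀) : E) = ((⟨x, hx⟩ - y : Q) : E) := by
      rw [← hsx]; rfl
    rw [hcoe]
    exact hmem

/-- Contraction `W ⊗ E → W` with a linear form on `E`. -/
def contract {O W E : Type*} [CommRing O] [AddCommGroup W] [Module O W] [AddCommGroup E]
    [Module O E] (s : E →ₗ[O] O) : W ⊗[O] E →ₗ[O] W :=
  (TensorProduct.rid O W).toLinearMap ∘ₗ s.lTensor W

@[simp]
theorem contract_tmul {O W E : Type*} [CommRing O] [AddCommGroup W] [Module O W]
    [AddCommGroup E] [Module O E] (s : E →ₗ[O] O) (w : W) (x : E) :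
    contract s (w ⊗ₜ[O] x) = s x • w := by
  simp [contract]

variable {A O} in
theorem contract_twist {Q : Submodule O (O ⊗[R] M)}
    {s : O ⊗[R] M →ₗ[O] O} (hs : ∀ x ∈ Q, s x = 0) {z : Ω[O⁄A] ⊗[O] (O ⊗[R] M)}
    (hz : z ∈ twist A Q) : contract s z = 0 := by
  have : twist A Q ≤ LinearMap.ker (contract s) := twist_le A fun w x hx => by simp [hs x hx]
  exact this hz

variable {A O} in
theorem sub_contract_mem_twist {Q T : Submodule O (O ⊗[R] M)} {t : O ⊗[R] M}
    {s : O ⊗[R] M →ₗ[O] O} (hs : ∀ x ∈ T, x - s x • t ∈ Q) {z : Ω[O⁄A] ⊗[O] (O ⊗[R] M)}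
    (hz : z ∈ twist A T) : z - contract s z ⊗ₜ[O] t ∈ twist A Q := by
  have : twist A T ≤ (twist A Q).comap
      (LinearMap.id - ((TensorProduct.mk O Ω[O⁄A] (O ⊗[R] M)).flip t) ∘ₗ contract s) :=
    twist_le A fun w x hx => by
      have : w ⊗ₜ[O] x - (s x • w) ⊗ₜ[O] t = w ⊗ₜ[O] (x - s x • t) := by
        rw [TensorProduct.tmul_sub, TensorProduct.smul_tmul]
      simp only [Submodule.mem_comap, LinearMap.sub_apply, LinearMap.id_apply,
        LinearMap.comp_apply, LinearMap.flip_apply, TensorProduct.mk_apply, contract_tmul, this]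
      exact tmul_mem_twist A w (hs x hx)
  simpa using this hz

variable {O} in
theorem exists_baseChange_functional (s : O ⊗[R] M →ₗ[O] O) :
    ∃ s' : O' ⊗[R] M →ₗ[O'] O', ∀ x, s' (eMapO O O' x) = algebraMap O O' (s x) :=
  ⟨(isBaseChange_eMapO O O').lift ((Algebra.linearMap O O') ∘ₗ s), fun x => by
    rw [IsBaseChange.lift_eq]; rfl⟩

theorem spanMap_split {Q T : Submodule O (O ⊗[R] M)} {t : O ⊗[R] M}
    {s : O ⊗[R] M →ₗ[O] O} {s' : O' ⊗[R] M →ₗ[O'] O'}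
    (hs' : ∀ x, s' (eMapO O O' x) = algebraMap O O' (s x))
    (hs : ∀ x ∈ T, x - s x • t ∈ Q) :
    ∀ x ∈ spanMap (IsScalarTower.toAlgHom R O O') T,
      x - s' x • eMapO O O' t ∈ spanMap (IsScalarTower.toAlgHom R O O') Q := by
  have : spanMap (IsScalarTower.toAlgHom R O O') T ≤
      (spanMap (IsScalarTower.toAlgHom R O O') Q).comap
        (LinearMap.id - (LinearMap.toSpanSingleton O' _ (eMapO O O' t)) ∘ₗ s') :=
    spanMap_induction O O' fun x hx => by
      have := eMapO_mem O O' (hs x hx)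
      simpa [hs', algebraMap_smul] using this
  intro x hx
  simpa using this hx

theorem spanMap_kill {Q : Submodule O (O ⊗[R] M)}
    {s : O ⊗[R] M →ₗ[O] O} {s' : O' ⊗[R] M →ₗ[O'] O'}
    (hs' : ∀ x, s' (eMapO O O' x) = algebraMap O O' (s x))
    (hs : ∀ x ∈ Q, s x = 0) :
    ∀ x ∈ spanMap (IsScalarTower.toAlgHom R O O') Q, s' x = 0 := by
  have : spanMap (IsScalarTower.toAlgHom R O O') Q ≤ LinearMap.ker s' :=
    spanMap_induction O O' fun x hx => by simp [hs', hs x hx]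
  exact this

theorem grBijective_baseChange [IsLocalRing O] (N : Connection k R M) {i : ℕ}
    {P Q T : Submodule O (O ⊗[R] M)} (hP : IsFramed i P) (hQ : IsFramed (i + 1) Q)
    (hT : IsFramed (i + 2) T) (hPQ : P ≤ Q) (hQT : Q ≤ T)
    (hΩ : IsBaseChange O' (KaehlerDifferential.map A A' O O'))
    (h₁ : N.MapsInto A P Q) (h₂ : N.MapsInto A Q T) (h : N.GrBijective A P Q T) :
    N.GrBijective A' (spanMap (IsScalarTower.toAlgHom R O O') P)
      (spanMap (IsScalarTower.toAlgHom R O O') Q)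
      (spanMap (IsScalarTower.toAlgHom R O O') T) := by
  obtain ⟨e, heQ, s, hsP, hse, hsQ⟩ := hP.exists_generator hQ hPQ
  obtain ⟨t, htT, τ, hτQ, hτt, hτT⟩ := hQ.exists_generator hT hQT
  have h₁' := mapsInto_baseChange A O A' O' N hPQ h₁
  have h₂' := mapsInto_baseChange A O A' O' N hQT h₂
  obtain ⟨s', hs'⟩ := exists_baseChange_functional O' s
  obtain ⟨τ', hτ'⟩ := exists_baseChange_functional O' τ
  set P' := spanMap (IsScalarTower.toAlgHom R O O') P
  set Q' := spanMap (IsScalarTower.toAlgHom R O O') Q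
  set T' := spanMap (IsScalarTower.toAlgHom R O O') T
  have hsQ' := spanMap_split O O' hs' hsQ
  have hτT' := spanMap_split O O' hτ' hτT
  have hτQ' := spanMap_kill O O' hτ' hτQ
  let ω : Ω[O⁄A] := contract τ (N.pull A O e)
  have key : ∀ v ∈ Q, contract τ (N.pull A O v) = s v • ω := by
    intro v hv
    have h0 : v = (v - s v • e) + s v • e := by abel
    rw [h0, map_add, Connection.pull_smul, map_add, map_add, map_smul,
      contract_twist hτQ (h₁ _ (hsQ v hv)), contract_tmul, hτQ e heQ, zero_smul,
      zero_add, add_zero, map_add, hsP _ (hsQ v hv), zero_add, map_smul, hse, smul_eq_mul, mul_one]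
  have hωbij : Function.Bijective (LinearMap.toSpanSingleton O Ω[O⁄A] ω) := by
    constructor
    · rw [← LinearMap.ker_eq_bot, LinearMap.ker_eq_bot']
      intro c hc
      have hce : c • e ∈ Q := Q.smul_mem _ heQ
      have := sub_contract_mem_twist hτT (h₂ _ hce)
      rw [key _ hce, map_smul s, hse, smul_eq_mul, mul_one] at this
      rw [LinearMap.toSpanSingleton_apply] at hc
      rw [hc, TensorProduct.zero_tmul, sub_zero] at this
      have := hsP _ (h.1 _ hce this)
      simpa [hse] using this
    · intro w
      obtain ⟨v, hv, hvw⟩ := h.2 (w ⊗ₜ[O] t) (tmul_mem_twist A w htT)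
      have := contract_twist hτQ hvw
      rw [map_sub, key v hv, contract_tmul, hτt, one_smul, sub_eq_zero] at this
      exact ⟨s v, by rw [LinearMap.toSpanSingleton_apply, this]⟩
  let ω' : Ω[O'⁄A'] := KaehlerDifferential.map A A' O O' ω
  have hω'bij : Function.Bijective (LinearMap.toSpanSingleton O' Ω[O'⁄A'] ω') := by
    let b : Module.Basis Unit O Ω[O⁄A] :=
      (Module.Basis.singleton Unit O).map (LinearEquiv.ofBijective _ hωbij)
    have hb : b () = ω := by simp [b]
    let b' := hΩ.basis b
    have hb' : b' () = ω' := by simp only [b', IsBaseChange.basis_apply, hb, ω']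
    constructor
    · rw [← LinearMap.ker_eq_bot, LinearMap.ker_eq_bot']
      intro c hc
      rw [LinearMap.toSpanSingleton_apply, ← hb'] at hc
      have := congrArg (fun z => b'.repr z ()) hc
      simpa using this
    · intro w
      refine ⟨b'.repr w (), ?_⟩
      have := b'.sum_repr w
      rw [LinearMap.toSpanSingleton_apply, ← hb']
      simpa using this
  have hc : ∀ z, contract τ' (tMap A O A' O' z) =
      KaehlerDifferential.map A A' O O' (contract τ z) := by
    intro z
    induction z with
    | zero => simp
    | tmul w x => simp [hτ', algebraMap_smul]
    | add x y hx hy => simp only [map_add, hx, hy]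
  have hτQ'' := fun z (hz : z ∈ twist A' Q') => contract_twist hτQ' hz
  have heQ' : eMapO O O' e ∈ Q' := eMapO_mem O O' heQ
  have key' : ∀ v ∈ Q', contract τ' (N.pull A' O' v) = s' v • ω' := by
    intro v hv
    have h0 : v = (v - s' v • eMapO O O' e) + s' v • eMapO O O' e := by abel
    conv_lhs => rw [h0]
    rw [map_add, Connection.pull_smul, map_add, map_add, map_smul,
      hτQ'' _ (h₁' _ (hsQ' v hv)), contract_tmul, hτQ' _ heQ', zero_smul,
      zero_add, add_zero, ← tMap_pull A O A' O', hc]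
  constructor
  · intro v hv hvQ
    have h1 := hτQ'' _ hvQ
    rw [key' v hv] at h1
    have h2 : s' v = 0 := hω'bij.1 (by simpa using h1)
    simpa [h2] using hsQ' v hv
  · intro w hw
    obtain ⟨c, hcw⟩ := hω'bij.2 (contract τ' w)
    rw [LinearMap.toSpanSingleton_apply] at hcw
    have hce : c • eMapO O O' e ∈ Q' := Q'.smul_mem _ heQ'
    refine ⟨_, hce, ?_⟩
    have h1 := sub_contract_mem_twist hτT' hw
    have h2 := sub_contract_mem_twist hτT' (h₂' _ hce)
    rw [key' _ hce, map_smul s', hs', hse, map_one, smul_eq_mul, mul_one, hcw] at h2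
    have := sub_mem h1 h2
    simpa using this

end BaseChange

section AlgHomBaseChange

variable {k R M : Type*} [CommRing k] [CommRing R] [Algebra k R] [AddCommGroup M] [Module R M]
  {A O A' O' : Type*} [CommRing A] [CommRing O] [CommRing A'] [CommRing O']
  [Algebra k A] [Algebra k O] [Algebra A O] [Algebra R O] [IsScalarTower k A O]
  [IsScalarTower k R O] [Algebra k A'] [Algebra k O'] [Algebra A' O'] [Algebra R O']
  [IsScalarTower k A' O'] [IsScalarTower k R O']

theorem Connection.MapsInto.spanMap (φ : A →ₐ[k] A') (θ : O →ₐ[R] O')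
    (hφ : ∀ a, θ (algebraMap A O a) = algebraMap A' O' (φ a)) (N : Connection k R M)
    {P Q : Submodule O (O ⊗[R] M)} (hPQ : P ≤ Q) (h : N.MapsInto A P Q) :
    N.MapsInto A' (spanMap θ P) (spanMap θ Q) := by
  let _ := φ.toRingHom.toAlgebra
  let _ := θ.toRingHom.toAlgebra
  let _ : Algebra A O' := ((algebraMap A' O').comp φ.toRingHom).toAlgebra
  have : IsScalarTower R O O' := .of_algebraMap_eq fun r => (θ.commutes r).symm
  have : IsScalarTower A A' O' := .of_algebraMap_eq fun _ => rfl
  have : IsScalarTower A O O' := .of_algebraMap_eq fun a => (hφ a).symm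
  exact mapsInto_baseChange A O A' O' N hPQ h

theorem Connection.GrBijective.spanMap [IsLocalRing O] (φ : A →ₐ[k] A') (θ : O →ₐ[R] O')
    (hφ : ∀ a, θ (algebraMap A O a) = algebraMap A' O' (φ a)) (N : Connection k R M)
    (hO : IsBaseChange O (KaehlerDifferential.map k A R O))
    (hO' : IsBaseChange O' (KaehlerDifferential.map k A' R O')) {i : ℕ}
    {P Q T : Submodule O (O ⊗[R] M)} (hP : IsFramed i P) (hQ : IsFramed (i + 1) Q)
    (hT : IsFramed (i + 2) T) (hPQ : P ≤ Q) (hQT : Q ≤ T)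
    (h₁ : N.MapsInto A P Q) (h₂ : N.MapsInto A Q T) (h : N.GrBijective A P Q T) :
    N.GrBijective A' (spanMap θ P) (spanMap θ Q) (spanMap θ T) := by
  let _ := φ.toRingHom.toAlgebra
  let _ := θ.toRingHom.toAlgebra
  let _ : Algebra A O' := ((algebraMap A' O').comp φ.toRingHom).toAlgebra
  have : IsScalarTower R O O' := .of_algebraMap_eq fun r => (θ.commutes r).symm
  have : IsScalarTower A A' O' := .of_algebraMap_eq fun _ => rfl
  have : IsScalarTower A O O' := .of_algebraMap_eq fun a => (hφ a).symm
  have hΩ : IsBaseChange O' (KaehlerDifferential.map A A' O O') := by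
    refine IsBaseChange.of_comp hO ?_
    convert! hO'
    exact LinearMap.ext fun w => kaehler_map_map A O A' O' w
  exact grBijective_baseChange A O A' O' N hP hQ hT hPQ hQT hΩ h₁ h₂ h

theorem isBasis_eMap (θ : O →ₐ[R] O') {ι : Type*} (b : Module.Basis ι O (O ⊗[R] M)) :
    ∃ b' : Module.Basis ι O' (O' ⊗[R] M), ∀ i, b' i = eMap θ (b i) := by
  let _ := θ.toRingHom.toAlgebra
  have : IsScalarTower R O O' := .of_algebraMap_eq fun r => (θ.commutes r).symm
  refine ⟨(isBaseChange_eMapO O O').basis b, fun x => ?_⟩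
  rw [IsBaseChange.basis_apply, eMapO_apply]
  rfl

end AlgHomBaseChange

/-! ### Families over `S × X`

`S = Spec A` is an affine `k`-scheme, `X = Spec R`, and `S × X = Spec (A ⊗[k] R)`. -/

section Geometry

open TopologicalSpace

attribute [local instance] Algebra.TensorProduct.rightAlgebra

variable {k R : Type u} (M : Type u) [CommRing k] [CommRing R] [Algebra k R]
  [AddCommGroup M] [Module R M]
variable {A A' A'' : Type u} [CommRing A] [Algebra k A] [CommRing A'] [Algebra k A']
  [CommRing A''] [Algebra k A'']

/-- The local ring of `S × X` at the point `p`. -/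
def Stalk (p : PrimeSpectrum (A ⊗[k] R)) : Type u := Localization.AtPrime p.asIdeal

instance (p : PrimeSpectrum (A ⊗[k] R)) : CommRing (Stalk p) :=
  inferInstanceAs (CommRing (Localization.AtPrime p.asIdeal))

instance (p : PrimeSpectrum (A ⊗[k] R)) : IsLocalRing (Stalk p) :=
  inferInstanceAs (IsLocalRing (Localization.AtPrime p.asIdeal))

instance (p : PrimeSpectrum (A ⊗[k] R)) : Algebra (A ⊗[k] R) (Stalk p) :=
  inferInstanceAs (Algebra (A ⊗[k] R) (Localization.AtPrime p.asIdeal))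

instance (p : PrimeSpectrum (A ⊗[k] R)) : IsLocalization.AtPrime (Stalk p) p.asIdeal :=
  inferInstanceAs (IsLocalization.AtPrime (Localization.AtPrime p.asIdeal) p.asIdeal)

instance (p : PrimeSpectrum (A ⊗[k] R)) : Algebra k (Stalk p) :=
  inferInstanceAs (Algebra k (Localization.AtPrime p.asIdeal))

instance (p : PrimeSpectrum (A ⊗[k] R)) : Algebra A (Stalk p) :=
  inferInstanceAs (Algebra A (Localization.AtPrime p.asIdeal))

instance (p : PrimeSpectrum (A ⊗[k] R)) : Algebra R (Stalk p) :=
  inferInstanceAs (Algebra R (Localization.AtPrime p.asIdeal))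

instance (p : PrimeSpectrum (A ⊗[k] R)) : IsScalarTower k A (Stalk p) :=
  inferInstanceAs (IsScalarTower k A (Localization.AtPrime p.asIdeal))

instance (p : PrimeSpectrum (A ⊗[k] R)) : IsScalarTower k R (Stalk p) :=
  inferInstanceAs (IsScalarTower k R (Localization.AtPrime p.asIdeal))

instance (p : PrimeSpectrum (A ⊗[k] R)) : IsScalarTower A (A ⊗[k] R) (Stalk p) :=
  inferInstanceAs (IsScalarTower A (A ⊗[k] R) (Localization.AtPrime p.asIdeal))

instance (p : PrimeSpectrum (A ⊗[k] R)) : IsScalarTower R (A ⊗[k] R) (Stalk p) :=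
  inferInstanceAs (IsScalarTower R (A ⊗[k] R) (Localization.AtPrime p.asIdeal))

/-- The stalk at `p` of the pull-back of `E` to `S × X`. -/
abbrev EStalk (p : PrimeSpectrum (A ⊗[k] R)) : Type u := Stalk p ⊗[R] M

variable (R) in
/-- The ring map of `S' × X → S × X` for a morphism `S' → S`. -/
def bc (φ : A →ₐ[k] A') : A ⊗[k] R →ₐ[R] A' ⊗[k] R :=
  { (Algebra.TensorProduct.map φ (AlgHom.id k R)).toRingHom with
    commutes' := fun r => by simp [Algebra.TensorProduct.right_algebraMap_apply] }

theorem bc_apply (φ : A →ₐ[k] A') (x : A ⊗[k] R) :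
    bc R φ x = Algebra.TensorProduct.map φ (AlgHom.id k R) x := rfl

theorem bc_id : bc R (AlgHom.id k A) = AlgHom.id R (A ⊗[k] R) := by
  ext x
  simp [bc_apply]

theorem bc_comp (φ : A →ₐ[k] A') (ψ : A' →ₐ[k] A'') :
    bc R (ψ.comp φ) = (bc R ψ).comp (bc R φ) := by
  refine AlgHom.ext fun x => ?_
  induction x with
  | zero => simp
  | tmul a r => simp [bc_apply]
  | add x y hx hy => simp only [map_add, hx, hy]

variable (R) in
/-- The map of spaces `S' × X → S × X` for a morphism `S' → S`. -/
def baseMap (φ : A →ₐ[k] A') : C(PrimeSpectrum (A' ⊗[k] R), PrimeSpectrum (A ⊗[k] R)) :=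
  ⟨PrimeSpectrum.comap (bc R φ).toRingHom, PrimeSpectrum.continuous_comap _⟩

/-- The map of local rings induced by `S' × X → S × X`. -/
def stalkHom (φ : A →ₐ[k] A') (p' : PrimeSpectrum (A' ⊗[k] R)) (q : PrimeSpectrum (A ⊗[k] R))
    (h : q = baseMap R φ p') : Stalk q →ₐ[R] Stalk p' :=
  Localization.localAlgHom q.asIdeal p'.asIdeal (bc R φ) (by rw [h]; rfl)

theorem stalkHom_to_map (φ : A →ₐ[k] A') (p' : PrimeSpectrum (A' ⊗[k] R))
    (q : PrimeSpectrum (A ⊗[k] R)) (h : q = baseMap R φ p') (x : A ⊗[k] R) :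
    stalkHom φ p' q h (algebraMap (A ⊗[k] R) (Stalk q) x) =
      algebraMap (A' ⊗[k] R) (Stalk p') (bc R φ x) :=
  Localization.localRingHom_to_map q.asIdeal p'.asIdeal (bc R φ).toRingHom (by rw [h]; rfl) x

theorem stalkHom_algebraMap (φ : A →ₐ[k] A') (p' : PrimeSpectrum (A' ⊗[k] R))
    (q : PrimeSpectrum (A ⊗[k] R)) (h : q = baseMap R φ p') (a : A) :
    stalkHom φ p' q h (algebraMap A (Stalk q) a) = algebraMap A' (Stalk p') (φ a) := by
  have h1 : algebraMap A (Stalk q) a =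
      algebraMap (A ⊗[k] R) (Stalk q) (algebraMap A (A ⊗[k] R) a) :=
    IsScalarTower.algebraMap_apply _ _ _ _
  have h2 : algebraMap A' (Stalk p') (φ a) =
      algebraMap (A' ⊗[k] R) (Stalk p') (algebraMap A' (A' ⊗[k] R) (φ a)) :=
    IsScalarTower.algebraMap_apply _ _ _ _
  rw [h1, h2]
  rw [stalkHom_to_map]
  simp [bc_apply]

theorem isBaseChange_kaehler_prod :
    IsBaseChange (A ⊗[k] R) (KaehlerDifferential.map k A R (A ⊗[k] R)) := by
  convert! (TensorProduct.isBaseChange R Ω[R⁄k] (A ⊗[k] R)).comp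
    (IsBaseChange.ofEquiv (KaehlerDifferential.tensorKaehlerEquiv k A R (A ⊗[k] R)))
  refine LinearMap.ext fun w => ?_
  have hw : w ∈ Submodule.span R (Set.range (D k R)) := by
    rw [KaehlerDifferential.span_range_derivation]; trivial
  induction hw using Submodule.span_induction with
  | mem w h =>
    obtain ⟨a, rfl⟩ := h
    simp only [KaehlerDifferential.map_D, LinearMap.comp_apply, LinearMap.coe_restrictScalars,
      TensorProduct.mk_apply, LinearEquiv.coe_coe, KaehlerDifferential.tensorKaehlerEquiv_tmul_D,
      one_smul]
  | zero => simp
  | add x y _ _ hx hy => simp only [map_add, hx, hy]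
  | smul c x _ hx => rw [map_smul, map_smul, hx]

theorem isBaseChange_kaehler_stalk (p : PrimeSpectrum (A ⊗[k] R)) :
    IsBaseChange (Stalk p) (KaehlerDifferential.map k A R (Stalk p)) := by
  have : Algebra.FormallyEtale (A ⊗[k] R) (Stalk p) :=
    Algebra.FormallyEtale.of_isLocalization p.asIdeal.primeCompl
  convert! isBaseChange_kaehler_prod.comp
    (KaehlerDifferential.isBaseChange_of_formallyEtale A (A ⊗[k] R) (Stalk p))
  exact LinearMap.ext fun w => (kaehler_map_map A (A ⊗[k] R) A (Stalk p) w).symm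

/-- A domain `U ⋐ S × X`: an open subset that surjects onto `S`. -/
structure Dom (k R A : Type u) [CommRing k] [CommRing R] [Algebra k R] [CommRing A]
    [Algebra k A] where
  carrier : Opens (PrimeSpectrum (A ⊗[k] R))
  surj : ∀ s : PrimeSpectrum A, ∃ p ∈ carrier,
    PrimeSpectrum.comap (algebraMap A (A ⊗[k] R)) p = s

theorem exists_ring (f₁ : A →+* A') {B : Type u} [CommRing B] (f₂ : A →+* B)
    (s : PrimeSpectrum A') (p : PrimeSpectrum B)
    (h : PrimeSpectrum.comap f₂ p = PrimeSpectrum.comap f₁ s) :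
    ∃ (L : Type u) (_ : Field L) (j₁ : A' →+* L) (j₂ : B →+* L), j₁.comp f₁ = j₂.comp f₂ ∧
      RingHom.ker j₁ = s.asIdeal ∧ RingHom.ker j₂ = p.asIdeal := by
  let q := PrimeSpectrum.comap f₁ s
  let F₁ : q.asIdeal.ResidueField →+* s.asIdeal.ResidueField :=
    Ideal.ResidueField.map q.asIdeal s.asIdeal f₁ rfl
  let F₂ : q.asIdeal.ResidueField →+* p.asIdeal.ResidueField :=
    Ideal.ResidueField.map q.asIdeal p.asIdeal f₂ (congrArg PrimeSpectrum.asIdeal h.symm)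
  let _ := F₁.toAlgebra
  let _ := F₂.toAlgebra
  let T := s.asIdeal.ResidueField ⊗[q.asIdeal.ResidueField] p.asIdeal.ResidueField
  obtain ⟨m, hm⟩ := Ideal.exists_maximal T
  let i₁ : s.asIdeal.ResidueField →+* T := Algebra.TensorProduct.includeLeftRingHom
  let i₂ : p.asIdeal.ResidueField →+* T :=
    (Algebra.TensorProduct.includeRight
      (R := q.asIdeal.ResidueField) (A := s.asIdeal.ResidueField)).toRingHom
  have hi : i₁.comp F₁ = i₂.comp F₂ := RingHom.ext fun a =>
    (Algebra.TensorProduct.includeLeft (R := q.asIdeal.ResidueField)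
      (S := q.asIdeal.ResidueField) (A := s.asIdeal.ResidueField)
      (B := p.asIdeal.ResidueField)).commutes a |>.trans
      ((Algebra.TensorProduct.includeRight (R := q.asIdeal.ResidueField)
        (A := s.asIdeal.ResidueField) (B := p.asIdeal.ResidueField)).commutes a).symm
  refine ⟨T ⧸ m, Ideal.Quotient.field m,
    ((Ideal.Quotient.mk m).comp i₁).comp (algebraMap A' _),
    ((Ideal.Quotient.mk m).comp i₂).comp (algebraMap B _), ?_, ?_, ?_⟩
  · ext a
    have h1 : algebraMap A' s.asIdeal.ResidueField (f₁ a) =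
        F₁ (algebraMap A q.asIdeal.ResidueField a) :=
      (Ideal.ResidueField.map_algebraMap q.asIdeal s.asIdeal f₁ rfl a).symm
    have h2 : algebraMap B p.asIdeal.ResidueField (f₂ a) =
        F₂ (algebraMap A q.asIdeal.ResidueField a) :=
      (Ideal.ResidueField.map_algebraMap q.asIdeal p.asIdeal f₂ _ a).symm
    have h3 := RingHom.congr_fun hi (algebraMap A q.asIdeal.ResidueField a)
    simp only [RingHom.comp_apply] at h3 ⊢
    rw [h1, h2, h3]
  · rw [← RingHom.comap_ker, (RingHom.injective_iff_ker_eq_bot _).1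
      (RingHom.injective ((Ideal.Quotient.mk m).comp i₁)), ← RingHom.ker_eq_comap_bot,
      Ideal.ker_algebraMap_residueField]
  · rw [← RingHom.comap_ker, (RingHom.injective_iff_ker_eq_bot _).1
      (RingHom.injective ((Ideal.Quotient.mk m).comp i₂)), ← RingHom.ker_eq_comap_bot,
      Ideal.ker_algebraMap_residueField]

theorem exists_point (φ : A →ₐ[k] A') (s : PrimeSpectrum A') (p : PrimeSpectrum (A ⊗[k] R))
    (h : PrimeSpectrum.comap (algebraMap A (A ⊗[k] R)) p = PrimeSpectrum.comap φ.toRingHom s) :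
    ∃ p' : PrimeSpectrum (A' ⊗[k] R), baseMap R φ p' = p ∧
      PrimeSpectrum.comap (algebraMap A' (A' ⊗[k] R)) p' = s := by
  obtain ⟨L, _, j₁, j₂, hj, h₁, h₂⟩ := exists_ring φ.toRingHom _ s p h
  replace hj : ∀ a, j₁ (φ a) = j₂ (algebraMap A (A ⊗[k] R) a) := fun a => RingHom.congr_fun hj a
  let _ : Algebra k L := (j₁.comp (algebraMap k A')).toAlgebra
  let g₁ : A' →ₐ[k] L := { j₁ with commutes' := fun _ => rfl }
  let g₂ : R →ₐ[k] L :=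
    { j₂.comp (algebraMap R (A ⊗[k] R)) with
      commutes' := fun c => by
        change j₂ (algebraMap R (A ⊗[k] R) (algebraMap k R c)) = j₁ (algebraMap k A' c)
        rw [← IsScalarTower.algebraMap_apply, IsScalarTower.algebraMap_apply k A (A ⊗[k] R),
          ← φ.commutes]
        exact (hj _).symm }
  let g : A' ⊗[k] R →ₐ[k] L := Algebra.TensorProduct.productMap g₁ g₂
  have hg₁ : ∀ a, g (algebraMap A' (A' ⊗[k] R) a) = j₁ a := fun a => by
    simp [g, g₁, Algebra.TensorProduct.algebraMap_apply]
  have hg₂ : ∀ x, g (bc R φ x) = j₂ x := by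
    intro x
    induction x with
    | zero => simp
    | tmul a r =>
      have : a ⊗ₜ[k] r = algebraMap A (A ⊗[k] R) a * algebraMap R (A ⊗[k] R) r := by
        simp [Algebra.TensorProduct.algebraMap_apply,
          Algebra.TensorProduct.right_algebraMap_apply]
      have h1 : g (bc R φ (a ⊗ₜ[k] r)) = j₁ (φ a) * j₂ (algebraMap R (A ⊗[k] R) r) := by
        simp [bc_apply, g, g₁, g₂]
      rw [h1, hj, this, map_mul]
    | add x y hx hy => simp only [map_add, hx, hy]
  refine ⟨PrimeSpectrum.comap g.toRingHom ⟨⊥, Ideal.isPrime_bot⟩, ?_, ?_⟩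
  · ext x
    rw [← h₂]
    change g (bc R φ x) = 0 ↔ _
    rw [hg₂, RingHom.mem_ker]
  · ext x
    rw [← h₁]
    change g (algebraMap A' (A' ⊗[k] R) x) = 0 ↔ _
    rw [hg₁, RingHom.mem_ker]

/-- The preimage of a domain under `S' × X → S × X`. -/
def Dom.pull (φ : A →ₐ[k] A') (U : Dom k R A) : Dom k R A' where
  carrier := Opens.comap (baseMap R φ) U.carrier
  surj s := by
    obtain ⟨p, hp, hps⟩ := U.surj (PrimeSpectrum.comap φ.toRingHom s)
    obtain ⟨p', h1, h2⟩ := exists_point φ s p hps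
    exact ⟨p', show baseMap R φ p' ∈ U.carrier by rwa [h1], h2⟩

/-- A choice of a submodule of every stalk of `E_U`. A subsheaf of `E_U` is determined by its
stalks, and `IsSubbundle` says which choices come from a sub-bundle. -/
abbrev Family (U : Opens (PrimeSpectrum (A ⊗[k] R))) : Type u :=
  ∀ p : U, Submodule (Stalk p.1) (EStalk M p.1)

variable {M}

/-- Restriction to a smaller open subset. -/
def Family.res {U V : Opens (PrimeSpectrum (A ⊗[k] R))} (h : V ≤ U) (F : Family M U) :
    Family M V := fun p => F ⟨p.1, h p.2⟩

/-- Pull-back along `S' × X → S × X`. -/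
def Family.pull (φ : A →ₐ[k] A') {U : Opens (PrimeSpectrum (A ⊗[k] R))} (F : Family M U) :
    Family M (Opens.comap (baseMap R φ) U) :=
  fun p => spanMap (stalkHom φ p.1 (baseMap R φ p.1) rfl) (F ⟨baseMap R φ p.1, p.2⟩)

theorem Family.pull_apply (φ : A →ₐ[k] A') {U : Opens (PrimeSpectrum (A ⊗[k] R))}
    (F : Family M U) (p : Opens.comap (baseMap R φ) U) (q : U) (h : q.1 = baseMap R φ p.1) :
    F.pull φ p = spanMap (stalkHom φ p.1 q.1 h) (F q) := by
  obtain ⟨q, hq⟩ := q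
  change q = _ at h
  subst h
  rfl

/-- The germ at `q` of a section of the pull-back of `E` to `S × X`. -/
def germ (q : PrimeSpectrum (A ⊗[k] R)) : (A ⊗[k] R) ⊗[R] M →ₗ[R] EStalk M q :=
  eMap (IsScalarTower.toAlgHom R (A ⊗[k] R) (Stalk q))

/-- `F` is (the collection of stalks of) a sub-bundle `F ≺ E_U` of rank `i`, that is, a locally
free subsheaf of rank `i` with locally free quotient: every point has a neighbourhood on which
there are sections `a₁, …, a_i, c₁, …, c_j` that form a basis of `E_U`, such that `a₁, …, a_i`
generate `F`. (The sections may be taken to extend to `S × X`, since this space is affine and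
sections on a basic open subset extend after multiplication by a unit.) -/
def IsSubbundle {U : Opens (PrimeSpectrum (A ⊗[k] R))} (i : ℕ) (F : Family M U) : Prop :=
  ∀ p : U, ∃ V : Opens (PrimeSpectrum (A ⊗[k] R)), p.1 ∈ V ∧
    ∃ (j : ℕ) (a : Fin i → (A ⊗[k] R) ⊗[R] M) (c : Fin j → (A ⊗[k] R) ⊗[R] M),
      ∀ q : U, q.1 ∈ V →
        (∃ b : Module.Basis (Fin i ⊕ Fin j) (Stalk q.1) (EStalk M q.1),
          ∀ x, b x = germ q.1 (Sum.elim a c x)) ∧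
        F q = Submodule.span (Stalk q.1) (Set.range fun x => germ q.1 (a x))

theorem IsSubbundle.isFramed {U : Opens (PrimeSpectrum (A ⊗[k] R))} {i : ℕ} {F : Family M U}
    (h : IsSubbundle i F) (p : U) :
    IsFramed i (F p) := by
  obtain ⟨V, hV, j, a, c, H⟩ := h p
  obtain ⟨⟨b, hb⟩, hF⟩ := H p hV
  exact ⟨j, b, by simp [hF, hb]⟩

theorem IsSubbundle.res {U V : Opens (PrimeSpectrum (A ⊗[k] R))} (hVU : V ≤ U) {i : ℕ}
    {F : Family M U} (h : IsSubbundle i F) : IsSubbundle i (F.res hVU) := fun p => by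
  obtain ⟨W, hW, j, a, c, H⟩ := h ⟨p.1, hVU p.2⟩
  exact ⟨W, hW, j, a, c, fun q hq => H ⟨q.1, hVU q.2⟩ hq⟩

theorem eMap_comp {O O' O'' : Type*} [CommRing O] [CommRing O'] [CommRing O''] [Algebra R O]
    [Algebra R O'] [Algebra R O''] (θ : O →ₐ[R] O') (θ' : O' →ₐ[R] O'') (x : O ⊗[R] M) :
    eMap (θ'.comp θ) x = eMap θ' (eMap θ x) := by
  simp [eMap, LinearMap.rTensor_comp]

theorem germ_pull (φ : A →ₐ[k] A') (p : PrimeSpectrum (A' ⊗[k] R))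
    (q : PrimeSpectrum (A ⊗[k] R)) (h : q = baseMap R φ p) (x : (A ⊗[k] R) ⊗[R] M) :
    eMap (stalkHom φ p q h) (germ q x) = germ p (eMap (bc R φ) x) := by
  rw [germ, germ, ← eMap_comp, ← eMap_comp]
  congr 2
  refine AlgHom.ext fun x => ?_
  exact stalkHom_to_map φ p q h x

theorem IsSubbundle.pull (φ : A →ₐ[k] A') {U : Opens (PrimeSpectrum (A ⊗[k] R))} {i : ℕ}
    {F : Family M U} (h : IsSubbundle i F) : IsSubbundle i (F.pull φ) := fun p => by
  obtain ⟨W, hW, j, a, c, H⟩ := h ⟨baseMap R φ p.1, p.2⟩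
  refine ⟨Opens.comap (baseMap R φ) W, hW, j, fun x => eMap (bc R φ) (a x),
    fun x => eMap (bc R φ) (c x), fun q hq => ?_⟩
  obtain ⟨⟨b, hb⟩, hF⟩ := H ⟨baseMap R φ q.1, q.2⟩ hq
  constructor
  · obtain ⟨b', hb'⟩ := isBasis_eMap (stalkHom φ q.1 (baseMap R φ q.1) rfl) b
    refine ⟨b', fun x => ?_⟩
    rw [hb', hb, germ_pull]
    cases x <;> rfl
  · change spanMap _ (F ⟨baseMap R φ q.1, q.2⟩) = _
    rw [hF, spanMap_span, ← Set.range_comp]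
    simp only [Function.comp_def, germ_pull]

/-- A partial oper of rank `r` on `U`: a flag `0 = F₀ ≺ F₁ ≺ ⋯ ≺ F_r ≺ E_U` of sub-bundles with
`rank F_i = i`, such that `∇` restricts to `F_i → ω ⊗ F_{i+1}` for `i + 1 ≤ r` and the induced maps
`F_{i+1} / F_i → ω ⊗ (F_{i+2} / F_{i+1})` are isomorphisms for `i + 2 ≤ r`. These conditions are
conditions on stalks.

If `E` has rank `n` and `r = n`, then `F_n = E_U`, and this is an oper for `GL(n)`. -/
structure IsPartialOper (N : Connection k R M) (r : ℕ) {U : Opens (PrimeSpectrum (A ⊗[k] R))}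
    (F : Fin (r + 1) → Family M U) : Prop where
  isSubbundle : ∀ i, IsSubbundle i.1 (F i)
  le : ∀ (i : ℕ) (hi : i + 1 ≤ r) (p : U),
    F ⟨i, by omega⟩ p ≤ F ⟨i + 1, by omega⟩ p
  mapsInto : ∀ (i : ℕ) (hi : i + 1 ≤ r) (p : U),
    N.MapsInto A (F ⟨i, by omega⟩ p) (F ⟨i + 1, by omega⟩ p)
  grBijective : ∀ (i : ℕ) (hi : i + 2 ≤ r) (p : U),
    N.GrBijective A (F ⟨i, by omega⟩ p) (F ⟨i + 1, by omega⟩ p) (F ⟨i + 2, by omega⟩ p)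

theorem IsPartialOper.res {N : Connection k R M} {r : ℕ}
    {U V : Opens (PrimeSpectrum (A ⊗[k] R))} (hVU : V ≤ U) {F : Fin (r + 1) → Family M U}
    (h : IsPartialOper N r F) : IsPartialOper N r fun i => (F i).res hVU where
  isSubbundle i := (h.isSubbundle i).res hVU
  le i hi p := h.le i hi ⟨p.1, hVU p.2⟩
  mapsInto i hi p := h.mapsInto i hi ⟨p.1, hVU p.2⟩
  grBijective i hi p := h.grBijective i hi ⟨p.1, hVU p.2⟩

theorem IsPartialOper.pull (φ : A →ₐ[k] A') {N : Connection k R M} {r : ℕ}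
    {U : Opens (PrimeSpectrum (A ⊗[k] R))} {F : Fin (r + 1) → Family M U}
    (h : IsPartialOper N r F) : IsPartialOper N r fun i => (F i).pull φ := by
  constructor
  · intro i
    exact (h.isSubbundle i).pull φ
  · intro i hi p
    exact Submodule.span_mono (Set.image_mono (h.le i hi ⟨baseMap R φ p.1, p.2⟩))
  · intro i hi p
    exact Connection.MapsInto.spanMap φ _ (stalkHom_algebraMap φ _ _ rfl) N
      (h.le i hi ⟨baseMap R φ p.1, p.2⟩) (h.mapsInto i hi ⟨baseMap R φ p.1, p.2⟩)
  · intro i hi p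
    exact Connection.GrBijective.spanMap φ _ (stalkHom_algebraMap φ _ _ rfl) N
      (isBaseChange_kaehler_stalk _) (isBaseChange_kaehler_stalk _)
      ((h.isSubbundle ⟨i, by omega⟩).isFramed ⟨baseMap R φ p.1, p.2⟩)
      ((h.isSubbundle ⟨i + 1, by omega⟩).isFramed ⟨baseMap R φ p.1, p.2⟩)
      ((h.isSubbundle ⟨i + 2, by omega⟩).isFramed ⟨baseMap R φ p.1, p.2⟩)
      (h.le i (by omega) ⟨baseMap R φ p.1, p.2⟩)
      (h.le (i + 1) (by omega) ⟨baseMap R φ p.1, p.2⟩)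
      (h.mapsInto i (by omega) ⟨baseMap R φ p.1, p.2⟩)
      (h.mapsInto (i + 1) (by omega) ⟨baseMap R φ p.1, p.2⟩)
      (h.grBijective i hi ⟨baseMap R φ p.1, p.2⟩)

theorem Family.pull_res (φ : A →ₐ[k] A') {U V : Opens (PrimeSpectrum (A ⊗[k] R))} (h : V ≤ U)
    (F : Family M U) :
    (F.res h).pull φ = (F.pull φ).res (fun _ hp => h hp :
      Opens.comap (baseMap R φ) V ≤ Opens.comap (baseMap R φ) U) := rfl

theorem baseMap_id (p : PrimeSpectrum (A ⊗[k] R)) : baseMap R (AlgHom.id k A) p = p := by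
  ext x
  change bc R (AlgHom.id k A) x ∈ p.asIdeal ↔ _
  rw [bc_id]
  rfl

theorem baseMap_comp (φ : A →ₐ[k] A') (ψ : A' →ₐ[k] A'') (p : PrimeSpectrum (A'' ⊗[k] R)) :
    baseMap R (ψ.comp φ) p = baseMap R φ (baseMap R ψ p) := by
  ext x
  change bc R (ψ.comp φ) x ∈ p.asIdeal ↔ bc R ψ (bc R φ x) ∈ p.asIdeal
  rw [bc_comp]
  rfl

theorem stalk_algHom_ext {B : Type u} [CommRing B] [Algebra R B] {p : PrimeSpectrum (A ⊗[k] R)}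
    {θ θ' : Stalk p →ₐ[R] B}
    (h : ∀ x, θ (algebraMap (A ⊗[k] R) (Stalk p) x) = θ' (algebraMap (A ⊗[k] R) (Stalk p) x)) :
    θ = θ' :=
  AlgHom.coe_ringHom_injective
    (IsLocalization.ringHom_ext p.asIdeal.primeCompl (RingHom.ext h))

theorem Family.pull_id {U : Opens (PrimeSpectrum (A ⊗[k] R))} (F : Family M U) :
    F.pull (AlgHom.id k A) = F.res (fun p hp => by
      have : baseMap R (AlgHom.id k A) p ∈ U := hp
      rwa [baseMap_id] at this) := by
  funext p
  have hp : p.1 ∈ U := by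
    have : baseMap R (AlgHom.id k A) p.1 ∈ U := p.2
    rwa [baseMap_id] at this
  rw [F.pull_apply (AlgHom.id k A) p ⟨p.1, hp⟩ (baseMap_id p.1).symm]
  have : stalkHom (AlgHom.id k A) p.1 p.1 (baseMap_id p.1).symm = AlgHom.id R _ :=
    stalk_algHom_ext fun x => by rw [stalkHom_to_map, bc_id]; rfl
  change spanMap (stalkHom (AlgHom.id k A) p.1 p.1 (baseMap_id p.1).symm) (F ⟨p.1, hp⟩) = _
  rw [this, spanMap_id]
  rfl

theorem Family.pull_comp (φ : A →ₐ[k] A') (ψ : A' →ₐ[k] A'')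
    {U : Opens (PrimeSpectrum (A ⊗[k] R))} (F : Family M U) :
    F.pull (ψ.comp φ) = ((F.pull φ).pull ψ).res (fun p hp => by
      have : baseMap R (ψ.comp φ) p ∈ U := hp
      rwa [baseMap_comp] at this) := by
  funext p
  have hp : baseMap R φ (baseMap R ψ p.1) ∈ U := by
    have : baseMap R (ψ.comp φ) p.1 ∈ U := p.2
    rwa [baseMap_comp] at this
  rw [F.pull_apply (ψ.comp φ) p ⟨_, hp⟩ (baseMap_comp φ ψ p.1).symm]
  change spanMap (stalkHom (ψ.comp φ) p.1 (baseMap R φ (baseMap R ψ p.1))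
    (baseMap_comp φ ψ p.1).symm) (F ⟨_, hp⟩) =
    spanMap (stalkHom ψ p.1 (baseMap R ψ p.1) rfl)
      (spanMap (stalkHom φ (baseMap R ψ p.1) (baseMap R φ (baseMap R ψ p.1)) rfl) (F ⟨_, hp⟩))
  rw [← spanMap_comp]
  congr 1
  refine stalk_algHom_ext fun x => ?_
  rw [AlgHom.comp_apply, stalkHom_to_map, stalkHom_to_map, stalkHom_to_map, bc_comp]
  rfl

/-! ### The presheaves of generic objects -/

variable (k R M) in
/-- A condition on `ι`-indexed families of submodules of the stalks of `E_U`, for all affine `S` and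
all open `U ⊆ S × X`, which is stable under restriction and under base change `S' → S`. -/
structure FamilyCondition (ι : Type) where
  Holds : ∀ {A : Type u} [CommRing A] [Algebra k A]
    {U : Opens (PrimeSpectrum (A ⊗[k] R))}, (ι → Family M U) → Prop
  res : ∀ {A : Type u} [CommRing A] [Algebra k A] {U V : Opens (PrimeSpectrum (A ⊗[k] R))}
    (h : V ≤ U) {F : ι → Family M U}, Holds F → Holds fun i => (F i).res h
  pull : ∀ {A A' : Type u} [CommRing A] [Algebra k A] [CommRing A'] [Algebra k A']
    (φ : A →ₐ[k] A') {U : Opens (PrimeSpectrum (A ⊗[k] R))} {F : ι → Family M U},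
    Holds F → Holds fun i => (F i).pull φ

namespace FamilyCondition

variable {ι ι' : Type} (C : FamilyCondition k R M ι) (C' : FamilyCondition k R M ι')

/-- The objects over `S = Spec A`, each supported on some domain `U ⋐ S × X`. -/
structure Sect (A : Type u) [CommRing A] [Algebra k A] where
  dom : Dom k R A
  fam : ι → Family M dom.carrier
  holds : C.Holds fam

variable {C} in
/-- Two objects have the same restriction to some common sub-domain. -/
def Sect.Rel (x y : C.Sect A) : Prop :=
  ∃ (V : Dom k R A) (hx : V.carrier ≤ x.dom.carrier) (hy : V.carrier ≤ y.dom.carrier),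
    ∀ i, (x.fam i).res hx = (y.fam i).res hy

variable {C} in
/-- Base change along `S' → S`. -/
def Sect.pull (φ : A →ₐ[k] A') (x : C.Sect A) : C.Sect A' where
  dom := x.dom.pull φ
  fam i := (x.fam i).pull φ
  holds := C.pull φ x.holds

variable {C} in
theorem Sect.Rel.pull (φ : A →ₐ[k] A') {x y : C.Sect A} (h : Sect.Rel x y) :
    Sect.Rel (x.pull φ) (y.pull φ) := by
  obtain ⟨V, hx, hy, H⟩ := h
  refine ⟨V.pull φ, fun p hp => hx hp, fun p hp => hy hp, fun i => ?_⟩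
  have h := congrArg (fun G : Family M V.carrier => G.pull φ) (H i)
  simp only [Family.pull_res] at h
  exact h

/-- The colimit over all domains `U ⋐ S × X` of the sets of objects supported on `U`. -/
def Germs (A : Type u) [CommRing A] [Algebra k A] : Type u := Quot (Sect.Rel (C := C) (A := A))

open CategoryTheory

/-- The presheaf of sets on affine `k`-schemes of finite type, `S ↦ colim_U {objects on U}`.
The category of these schemes is the opposite of the category `FGAlgCat k` of finitely generated
commutative `k`-algebras, so that a presheaf is a covariant functor on `FGAlgCat k`. -/
def presheaf : FGAlgCat.{u, u} k ⥤ Type u where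
  obj A := C.Germs A.obj
  map f := TypeCat.ofHom (Quot.map (Sect.pull f.hom.hom) fun _ _ h => h.pull f.hom.hom)
  map_id A := by
    ext x
    induction x using Quot.ind with
    | mk x =>
      refine Quot.sound ⟨x.dom.pull (AlgHom.id k _), le_rfl, ?_, fun i => ?_⟩
      · intro p hp
        have : baseMap R (AlgHom.id k _) p ∈ x.dom.carrier := hp
        rwa [baseMap_id] at this
      · exact (x.fam i).pull_id
  map_comp {A B D} f g := by
    ext x
    induction x using Quot.ind with
    | mk x =>
      refine Quot.sound ⟨x.dom.pull (g.hom.hom.comp f.hom.hom), le_rfl, ?_, fun i => ?_⟩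
      · intro p hp
        have : baseMap R (g.hom.hom.comp f.hom.hom) p ∈ x.dom.carrier := hp
        rwa [baseMap_comp] at this
      · exact (x.fam i).pull_comp f.hom.hom g.hom.hom

variable {C C'} in
/-- The map of presheaves that keeps only the members of a family with index in the image
of `e`. -/
def reindex (e : ι' → ι)
    (h : ∀ {A : Type u} [CommRing A] [Algebra k A] {U : Opens (PrimeSpectrum (A ⊗[k] R))}
      (F : ι → Family M U), C.Holds F → C'.Holds fun i => F (e i)) :
    C.presheaf ⟶ C'.presheaf where
  app A := TypeCat.ofHom (Quot.map (fun x => ⟨x.dom, fun i => x.fam (e i), h _ x.holds⟩)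
    fun _ _ ⟨V, hx, hy, H⟩ => ⟨V, hx, hy, fun i => H (e i)⟩)
  naturality A B f := by
    ext x
    induction x using Quot.ind with
    | mk x => rfl

end FamilyCondition

open CategoryTheory

/-- The condition to be a partial oper of rank `r`. -/
def partialOperCondition (N : Connection k R M) (r : ℕ) :
    FamilyCondition k R M (Fin (r + 1)) where
  Holds F := IsPartialOper N r F
  res h _ hF := hF.res h
  pull φ _ _ hF := hF.pull φ

variable (k R M) in
/-- The condition to be a sub-bundle of rank one. -/
def lineCondition : FamilyCondition k R M Unit where
  Holds F := IsSubbundle 1 (F ())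
  res h _ hF := hF.res h
  pull φ _ _ hF := hF.pull φ

/-- The presheaf of generic partial opers of rank `r`. For `r = n = rank E`, this is the
presheaf of generic `GL(n)`-opers. -/
def partialOpers (N : Connection k R M) (r : ℕ) : FGAlgCat.{u, u} k ⥤ Type u :=
  (partialOperCondition N r).presheaf

variable (k R M) in
/-- The presheaf of generic lines in `E`. -/
def genericLines : FGAlgCat.{u, u} k ⥤ Type u := (lineCondition k R M).presheaf

/-- The forgetful map `(F₀, …, F_r) ↦ (F₀, …, F_s)`. -/
def forgetOper (N : Connection k R M) {s r : ℕ} (h : s ≤ r) :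
    partialOpers N r ⟶ partialOpers N s :=
  FamilyCondition.reindex (Fin.castLE (by omega)) fun F hF =>
    { isSubbundle := fun i => hF.isSubbundle (Fin.castLE (by omega) i)
      le := fun i hi p => hF.le i (by omega) p
      mapsInto := fun i hi p => hF.mapsInto i (by omega) p
      grBijective := fun i hi p => hF.grBijective i (by omega) p }

/-- The map `(F₀, …, F_r) ↦ F₁`. -/
def firstLine (N : Connection k R M) {r : ℕ} (h : 1 ≤ r) :
    partialOpers N r ⟶ genericLines k R M :=
  FamilyCondition.reindex (fun _ => ⟨1, by omega⟩) fun F hF =>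
    hF.isSubbundle ⟨1, by omega⟩

end Geometry

end GenericOper

end

/-! Contracting with a vector field `θ` turns the connection, wherever `θ` does not vanish, into an
additive operator `T` on sections with `T (f x) = f T x + δ(f) x`. The isomorphism condition on the
graded pieces of a partial oper then reads `F_{i+2} = F_{i+1} + T F_{i+1}`. So the line `F_1`
determines the whole flag (`IsPartialOper.ext_line`). If `e` generates the line locally, the flag
can only be `F_i = ⟨e, T e, …, T^(i-1) e⟩`, and this is a partial oper as soon as `e, T e, …,
T^(n-1) e` is a frame, that is, as soon as `e` is a cyclic vector.

The point is thus to find a domain on which the line is locally generated by cyclic sections. Since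
`k` is algebraically closed, a closed point of `S` is a `k`-point `s`, and the generic point of the
fibre over `s` has the function field `K` of `X` as its residue field. The connection over `K` is
still irreducible: a stable subspace comes from its intersection with `E`, which is a stable
sub-bundle because a torsion-free finite module on a smooth curve is projective. Hence every nonzero
vector over `K` is cyclic (`cyclicFlag_eq_top`), because a flag of derivatives that stops growing is
stable. A determinant argument lifts this to the local ring, and cyclicity then spreads to a
neighbourhood.

The union of these neighbourhoods contains the generic points of all closed fibres. The projection
to `S` is open and every point of `S` specializes to a closed one, so this union surjects onto `S`
and is a domain (`Dom.ofFibreGenericPoint`). This proves the statement on lines; the one on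
forgetful maps follows by two-out-of-three. -/

noncomputable section

namespace GenericOper

/-! ### Contraction of the connection with a vector field. -/

section Differentiation

variable {k R M : Type*} [CommRing k] [CommRing R] [Algebra k R] [AddCommGroup M] [Module R M]

/-- Contraction `W ⊗ E → E` with a linear form on `W`. -/
def contractForm {O W E : Type*} [CommRing O] [AddCommGroup W] [Module O W] [AddCommGroup E]
    [Module O E] (Θ : W →ₗ[O] O) : W ⊗[O] E →ₗ[O] E :=
  (TensorProduct.lid O E).toLinearMap ∘ₗ Θ.rTensor E

@[simp]
theorem contractForm_tmul {O W E : Type*} [CommRing O] [AddCommGroup W] [Module O W]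
    [AddCommGroup E] [Module O E] (Θ : W →ₗ[O] O) (w : W) (x : E) :
    contractForm Θ (w ⊗ₜ[O] x) = Θ w • x := by
  simp [contractForm]

variable {A O : Type*} [CommRing A] [CommRing O] [Algebra k A] [Algebra k O] [Algebra A O]
  [Algebra R O] [IsScalarTower k A O] [IsScalarTower k R O]

/-- Differentiation of sections of the pull-back of `E` along the vector field given by a linear
form on the module of relative differentials. -/
def Connection.along (N : Connection k R M) (Θ : Ω[O⁄A] →ₗ[O] O) : O ⊗[R] M →+ O ⊗[R] M :=
  (contractForm Θ).toAddMonoidHom.comp (N.pull A O)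

theorem Connection.along_apply (N : Connection k R M) (Θ : Ω[O⁄A] →ₗ[O] O) (x : O ⊗[R] M) :
    N.along Θ x = contractForm Θ (N.pull A O x) := rfl

theorem Connection.along_smul (N : Connection k R M) (Θ : Ω[O⁄A] →ₗ[O] O) (f : O)
    (x : O ⊗[R] M) : N.along Θ (f • x) = f • N.along Θ x + Θ (D A O f) • x := by
  simp [Connection.along_apply, Connection.pull_smul]

/-- A bijective form makes `Ω[O⁄A]` free on the element `w₀` with `Θ w₀ = 1`, so every `z` equals
`w₀ ⊗ contractForm Θ z`. Twists by `ω` can then be dropped from the oper conditions, as the next two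
lemmas do. -/
theorem mem_twist_iff {Θ : Ω[O⁄A] →ₗ[O] O} (hΘ : Function.Bijective Θ)
    {Q : Submodule O (O ⊗[R] M)} {z : Ω[O⁄A] ⊗[O] (O ⊗[R] M)} :
    z ∈ twist A Q ↔ contractForm Θ z ∈ Q := by
  constructor
  · intro hz
    have : twist A Q ≤ Q.comap (contractForm Θ) :=
      twist_le A fun w x hx => by simpa using Q.smul_mem _ hx
    exact this hz
  · intro hz
    obtain ⟨w₀, hw₀⟩ := hΘ.2 1
    have : z = w₀ ⊗ₜ[O] contractForm Θ z := by
      clear hz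
      induction z with
      | zero => simp
      | tmul w x =>
        have hw : w = Θ w • w₀ := hΘ.1 (by simp [hw₀])
        rw [contractForm_tmul, ← TensorProduct.smul_tmul, ← hw]
      | add x y hx hy => rw [map_add, TensorProduct.tmul_add, ← hx, ← hy]
    rw [this]
    exact tmul_mem_twist A w₀ hz

theorem Connection.mapsInto_iff (N : Connection k R M) {Θ : Ω[O⁄A] →ₗ[O] O}
    (hΘ : Function.Bijective Θ) {P Q : Submodule O (O ⊗[R] M)} :
    N.MapsInto A P Q ↔ ∀ v ∈ P, N.along Θ v ∈ Q :=
  forall₂_congr fun _ _ => mem_twist_iff hΘ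

theorem Connection.grBijective_iff (N : Connection k R M) {Θ : Ω[O⁄A] →ₗ[O] O}
    (hΘ : Function.Bijective Θ) {P Q T : Submodule O (O ⊗[R] M)} :
    N.GrBijective A P Q T ↔ (∀ v ∈ Q, N.along Θ v ∈ Q → v ∈ P) ∧
      ∀ x ∈ T, ∃ v ∈ Q, x - N.along Θ v ∈ Q := by
  refine and_congr (forall₂_congr fun v _ => by rw [mem_twist_iff hΘ]; rfl) ⟨fun h x hx => ?_,
    fun h w hw => ?_⟩
  · obtain ⟨w₀, hw₀⟩ := hΘ.2 1
    obtain ⟨v, hv, hvx⟩ := h (w₀ ⊗ₜ[O] x) (tmul_mem_twist A w₀ hx)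
    rw [mem_twist_iff hΘ, map_sub, contractForm_tmul, hw₀, one_smul] at hvx
    exact ⟨v, hv, hvx⟩
  · obtain ⟨v, hv, hvx⟩ := h _ ((mem_twist_iff hΘ).1 hw)
    exact ⟨v, hv, by rwa [mem_twist_iff hΘ, map_sub]⟩

section BaseChange

variable {A' O' : Type*} [CommRing A'] [CommRing O'] [Algebra k A'] [Algebra k O'] [Algebra A' O']
  [Algebra R O'] [IsScalarTower k A' O'] [IsScalarTower k R O']

/-- The linear form on `Ω[O⁄A]` induced by a linear form on `Ω[R⁄k]`. -/
def liftForm (hO : IsBaseChange O (KaehlerDifferential.map k A R O)) (θ : Ω[R⁄k] →ₗ[R] R) :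
    Ω[O⁄A] →ₗ[O] O :=
  hO.lift (Algebra.linearMap R O ∘ₗ θ)

theorem liftForm_map (hO : IsBaseChange O (KaehlerDifferential.map k A R O))
    (θ : Ω[R⁄k] →ₗ[R] R) (w : Ω[R⁄k]) :
    liftForm hO θ (KaehlerDifferential.map k A R O w) = algebraMap R O (θ w) := by
  rw [liftForm, IsBaseChange.lift_eq]; rfl

/-- The two induced forms agree on the image of `Ω[R⁄k]`, which generates `Ω[O⁄A]`, so they are
compatible with base change; the pulled-back connections are compatible by `tMap_pull`. This is used
both for passing to germs and for restricting to the generic point of a closed fibre. -/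
theorem eMap_along (φ : A →ₐ[k] A') (η : O →ₐ[R] O')
    (hφ : ∀ a, η (algebraMap A O a) = algebraMap A' O' (φ a)) (N : Connection k R M)
    (hO : IsBaseChange O (KaehlerDifferential.map k A R O))
    (hO' : IsBaseChange O' (KaehlerDifferential.map k A' R O'))
    (θ : Ω[R⁄k] →ₗ[R] R) (x : O ⊗[R] M) :
    eMap η (N.along (liftForm hO θ) x) = N.along (liftForm hO' θ) (eMap η x) := by
  let _ := φ.toRingHom.toAlgebra
  let _ := η.toRingHom.toAlgebra
  let _ : Algebra A O' := ((algebraMap A' O').comp φ.toRingHom).toAlgebra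
  have : IsScalarTower R O O' := .of_algebraMap_eq fun r => (η.commutes r).symm
  have : IsScalarTower A A' O' := .of_algebraMap_eq fun _ => rfl
  have : IsScalarTower A O O' := .of_algebraMap_eq fun a => (hφ a).symm
  have hform : ∀ w, liftForm hO' θ (KaehlerDifferential.map A A' O O' w) =
      algebraMap O O' (liftForm hO θ w) := by
    have : (liftForm hO' θ).restrictScalars O ∘ₗ KaehlerDifferential.map A A' O O' =
        Algebra.linearMap O O' ∘ₗ liftForm hO θ := hO.algHom_ext _ _ fun w => by
      simp only [LinearMap.comp_apply, LinearMap.coe_restrictScalars, kaehler_map_map,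
        liftForm_map, Algebra.linearMap_apply, ← IsScalarTower.algebraMap_apply R O O']
    exact fun w => LinearMap.congr_fun this w
  have hcontract : ∀ z : Ω[O⁄A] ⊗[O] (O ⊗[R] M),
      contractForm (liftForm hO' θ) (tMap A O A' O' z) = eMapO O O' (contractForm (liftForm hO θ) z) := by
    intro z
    induction z with
    | zero => simp
    | tmul w x => simp only [tMap_tmul, contractForm_tmul, hform, algebraMap_smul, map_smul]
    | add x y hx hy => simp only [map_add, hx, hy]
  have key : eMap (IsScalarTower.toAlgHom R O O') (N.along (liftForm hO θ) x) =
      N.along (liftForm hO' θ) (eMap (IsScalarTower.toAlgHom R O O') x) := by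
    rw [← eMapO_apply, ← eMapO_apply, Connection.along_apply, Connection.along_apply,
      ← tMap_pull A O A' O', hcontract]
  exact key

theorem eMap_iterate_along (φ : A →ₐ[k] A') (η : O →ₐ[R] O')
    (hφ : ∀ a, η (algebraMap A O a) = algebraMap A' O' (φ a)) (N : Connection k R M)
    (hO : IsBaseChange O (KaehlerDifferential.map k A R O))
    (hO' : IsBaseChange O' (KaehlerDifferential.map k A' R O'))
    (θ : Ω[R⁄k] →ₗ[R] R) (j : ℕ) (x : O ⊗[R] M) :
    eMap η ((N.along (liftForm hO θ))^[j] x) = (N.along (liftForm hO' θ))^[j] (eMap η x) :=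
  Function.Semiconj.iterate_right (f := eMap η) (eMap_along φ η hφ N hO hO' θ) j x

theorem Connection.along_one_tmul (N : Connection k R M)
    (hO : IsBaseChange O (KaehlerDifferential.map k A R O)) (θ : Ω[R⁄k] →ₗ[R] R) (m : M) :
    N.along (liftForm hO θ) ((1 : O) ⊗ₜ[R] m) =
      (1 : O) ⊗ₜ[R] (contractForm θ (N.toFun m)) := by
  rw [Connection.along_apply, Connection.pull_tmul]
  simp only [one_smul, Derivation.map_one_eq_zero, TensorProduct.zero_tmul, add_zero]
  induction N.toFun m with
  | zero => simp
  | tmul w m =>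
    simp only [twistPull_tmul, contractForm_tmul, liftForm_map, algebraMap_smul,
      TensorProduct.tmul_smul]
  | add x y hx hy => simp only [map_add, hx, hy, TensorProduct.tmul_add]

/-- Relative differentials are pulled back from the line bundle `ω_X`, hence free of rank one over a
local ring. -/
theorem nonempty_equiv_kaehler [IsLocalRing O] [Module.Finite R Ω[R⁄k]]
    [Module.Projective R Ω[R⁄k]]
    (hX : ∀ x : PrimeSpectrum R, Module.rankAtStalk Ω[R⁄k] x = 1)
    (hO : IsBaseChange O (KaehlerDifferential.map k A R O)) :
    Nonempty (O ≃ₗ[O] Ω[O⁄A]) := by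
  have : Module.Finite O Ω[O⁄A] := Module.Finite.equiv hO.equiv
  have : Module.Projective O Ω[O⁄A] := Module.Projective.of_equiv hO.equiv
  have : Module.Free O Ω[O⁄A] := Module.free_of_flat_of_isLocalRing
  have h1 := Module.rankAtStalk_isBaseChange hO (IsLocalRing.closedPoint O)
  rw [hX, Module.rankAtStalk_eq_finrank_of_free] at h1
  exact ⟨LinearEquiv.ofFinrankEq _ _ (by simpa using h1.symm)⟩

/-- The unit hypothesis says that the vector field does not vanish at the point. The form is then
onto, and a surjective linear map between free modules of rank one is injective. -/
theorem liftForm_bijective [IsLocalRing O] [Module.Finite R Ω[R⁄k]] [Module.Projective R Ω[R⁄k]]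
    (hX : ∀ x : PrimeSpectrum R, Module.rankAtStalk Ω[R⁄k] x = 1)
    (hO : IsBaseChange O (KaehlerDifferential.map k A R O)) (θ : Ω[R⁄k] →ₗ[R] R) (w : Ω[R⁄k])
    (hw : IsUnit (algebraMap R O (θ w))) : Function.Bijective (liftForm hO θ) := by
  obtain ⟨e⟩ := nonempty_equiv_kaehler hX hO
  have hsurj : Function.Surjective (liftForm hO θ) := by
    intro c
    obtain ⟨u, hu⟩ := hw
    refine ⟨(c * ↑u⁻¹) • KaehlerDifferential.map k A R O w, ?_⟩
    rw [map_smul, liftForm_map, ← hu, smul_eq_mul, mul_assoc, Units.inv_mul, mul_one]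
  have hinj := OrzechProperty.injective_of_surjective_endomorphism
    (liftForm hO θ ∘ₗ e.toLinearMap) (hsurj.comp e.surjective)
  refine ⟨fun x y hxy => ?_, hsurj⟩
  have := @hinj (e.symm x) (e.symm y) (by simpa using hxy)
  simpa using this

end BaseChange

end Differentiation

/-! ### Flags generated by iterated derivatives. -/

section Flag

variable {O E : Type*} [CommRing O] [AddCommGroup E] [Module O E]

/-- The submodule spanned by `e, T e, …, T^(i-1) e`. -/
def cyclicFlag (T : E →+ E) (e : E) (i : ℕ) : Submodule O E :=
  Submodule.span O (Set.range fun j : Fin i => T^[j] e)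

theorem iterate_mem_cyclicFlag (T : E →+ E) (e : E) {i j : ℕ} (h : j < i) :
    T^[j] e ∈ cyclicFlag (O := O) T e i :=
  Submodule.subset_span ⟨⟨j, h⟩, rfl⟩

theorem cyclicFlag_mono (T : E →+ E) (e : E) : Monotone (cyclicFlag (O := O) T e) := by
  intro i i' h
  refine Submodule.span_le.2 ?_
  rintro _ ⟨j, rfl⟩
  exact iterate_mem_cyclicFlag T e (j.2.trans_le h)

theorem exists_sub_mem_cyclicFlag (T : E →+ E) (e : E) {i : ℕ} {x : E}
    (hx : x ∈ cyclicFlag (O := O) T e (i + 1)) :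
    ∃ c : O, x - c • T^[i] e ∈ cyclicFlag (O := O) T e i := by
  induction hx using Submodule.span_induction with
  | mem x h =>
    obtain ⟨j, rfl⟩ := h
    rcases Nat.lt_succ_iff_lt_or_eq.1 j.2 with h | h
    · exact ⟨0, by simpa using iterate_mem_cyclicFlag T e h⟩
    · exact ⟨1, by simp [h]⟩
  | zero => exact ⟨0, by simp⟩
  | add x y _ _ hx hy =>
    obtain ⟨c, hc⟩ := hx
    obtain ⟨c', hc'⟩ := hy
    refine ⟨c + c', ?_⟩
    have : x + y - (c + c') • T^[i] e = (x - c • T^[i] e) + (y - c' • T^[i] e) := by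
      rw [add_smul]; abel
    rw [this]
    exact add_mem hc hc'
  | smul a x _ hx =>
    obtain ⟨c, hc⟩ := hx
    refine ⟨a * c, ?_⟩
    rw [mul_smul, ← smul_sub]
    exact Submodule.smul_mem _ _ hc

variable {T : E →+ E} {δ : O → O}

theorem map_mem_cyclicFlag (hT : ∀ (f : O) (x : E), T (f • x) = f • T x + δ f • x)
    (e : E) {i : ℕ} {x : E} (hx : x ∈ cyclicFlag (O := O) T e i) :
    T x ∈ cyclicFlag (O := O) T e (i + 1) := by
  induction hx using Submodule.span_induction with
  | mem x h =>
    obtain ⟨j, rfl⟩ := h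
    rw [← Function.iterate_succ_apply' T j e]
    exact iterate_mem_cyclicFlag T e (by omega)
  | zero => simp
  | add x y _ _ hx hy => rw [map_add]; exact add_mem hx hy
  | smul a x hx' hx =>
    rw [hT]
    exact add_mem (Submodule.smul_mem _ _ hx)
      (Submodule.smul_mem _ _ (cyclicFlag_mono T e (Nat.le_succ i) hx'))

/-- Write `v = c T^i e` plus an element of `F_i`. By Leibniz, `T v` is `c T^(i+1) e` modulo
`F_{i+1}`, so `c T^(i+1) e` lies in `F_{i+1}` and independence forces `c = 0`. The bound `i + 2 ≤ n`
places `T^(i+1) e` among the independent vectors. -/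
theorem cyclicFlag_gr_injective (hT : ∀ (f : O) (x : E), T (f • x) = f • T x + δ f • x)
    {e : E} {n : ℕ}
    (hli : LinearIndependent O fun j : Fin n => T^[j] e) {i : ℕ} (hi : i + 2 ≤ n) {v : E}
    (hv : v ∈ cyclicFlag (O := O) T e (i + 1)) (hTv : T v ∈ cyclicFlag (O := O) T e (i + 1)) :
    v ∈ cyclicFlag (O := O) T e i := by
  obtain ⟨c, hc⟩ := exists_sub_mem_cyclicFlag T e hv
  have h1 : c • T^[i + 1] e ∈ cyclicFlag (O := O) T e (i + 1) := by
    have h2 := map_mem_cyclicFlag hT e hc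
    rw [map_sub, hT, ← Function.iterate_succ_apply' T i e] at h2
    have h3 := sub_mem (sub_mem hTv h2)
      (Submodule.smul_mem _ (δ c) (iterate_mem_cyclicFlag (O := O) T e (Nat.lt_succ_self i)))
    convert h3 using 1
    abel
  -- The generators of `F_{i+1}` have order at most `i`, so they lie among the independent vectors
  -- other than `T^(i+1) e`.
  have h0 : c = 0 := by
    have hs : cyclicFlag (O := O) T e (i + 1) ≤ Submodule.span O
        ((fun j : Fin n => T^[j] e) '' (Set.univ \ {⟨i + 1, by omega⟩})) := by
      refine Submodule.span_le.2 ?_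
      rintro _ ⟨j, rfl⟩
      refine Submodule.subset_span ⟨⟨j, by omega⟩, ⟨trivial, ?_⟩, rfl⟩
      intro h
      have := congrArg Fin.val (Set.mem_singleton_iff.1 h)
      simp only at this
      omega
    exact linearIndependent_iff_eq_zero_of_smul_mem_span.1 hli ⟨i + 1, by omega⟩ c (hs h1)
  simpa [h0] using hc

/-- If `x` has leading term `c T^(i+1) e`, take `v = c T^i e`; the Leibniz correction `δ c • T^i e`
stays in `F_{i+1}`. -/
theorem cyclicFlag_gr_surjective (hT : ∀ (f : O) (x : E), T (f • x) = f • T x + δ f • x)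
    (e : E) {i : ℕ} {x : E}
    (hx : x ∈ cyclicFlag (O := O) T e (i + 2)) :
    ∃ v ∈ cyclicFlag (O := O) T e (i + 1), x - T v ∈ cyclicFlag (O := O) T e (i + 1) := by
  obtain ⟨c, hc⟩ := exists_sub_mem_cyclicFlag T e hx
  have hi := iterate_mem_cyclicFlag (O := O) T e (Nat.lt_succ_self i)
  refine ⟨c • T^[i] e, Submodule.smul_mem _ _ hi, ?_⟩
  rw [hT, ← Function.iterate_succ_apply' T i e, ← sub_sub]
  exact sub_mem hc (Submodule.smul_mem _ _ hi)

/-- The submodule spanned by the derivatives of order `< i` of the elements of `L`. -/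
def derivedFlag (T : E →+ E) (L : Submodule O E) (i : ℕ) : Submodule O E :=
  Submodule.span O {y | ∃ j < i, ∃ x ∈ L, T^[j] x = y}

/-- By Leibniz, the derivative of order `j` of a multiple of `e` stays in `F_{j+1}`. Hence the flag
depends on the line only, and flags computed with different local generators agree without any
gluing. -/
theorem derivedFlag_span_singleton
    (hT : ∀ (f : O) (x : E), T (f • x) = f • T x + δ f • x) (e : E) (i : ℕ) :
    derivedFlag T (Submodule.span O {e}) i = cyclicFlag T e i := by
  apply le_antisymm <;> refine Submodule.span_le.2 ?_
  · rintro _ ⟨j, hj, x, hx, rfl⟩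
    obtain ⟨c, rfl⟩ := Submodule.mem_span_singleton.1 hx
    refine cyclicFlag_mono T e (Nat.succ_le_of_lt hj) ?_
    clear hj hx
    induction j with
    | zero => exact Submodule.smul_mem _ _ (iterate_mem_cyclicFlag T e Nat.one_pos)
    | succ j ih => rw [Function.iterate_succ_apply']; exact map_mem_cyclicFlag hT e ih
  · rintro _ ⟨j, rfl⟩
    exact Submodule.subset_span ⟨j, j.2, e, Submodule.mem_span_singleton_self e, rfl⟩

theorem derivedFlag_one (L : Submodule O E) : derivedFlag T L 1 = L := by
  have : {y | ∃ j < 1, ∃ x ∈ L, T^[j] x = y} = (L : Set E) := by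
    ext y; simp
  rw [derivedFlag, this, Submodule.span_eq]

end Flag

/-! ### Cyclic vectors over a field. -/

section Cyclic

variable {K E : Type*} [Field K] [AddCommGroup E] [Module K E]

/-- The dimension grows by at least one at each step until the flag stops. Where `F_{i+1} = F_i`,
this subspace is `T`-stable, and it is nonzero since it contains `e`, so irreducibility makes it
everything. -/
theorem cyclicFlag_eq_top [Module.Finite K E] {T : E →+ E} {δ : K → K}
    (hT : ∀ (f : K) (x : E), T (f • x) = f • T x + δ f • x)
    (hirr : ∀ W : Submodule K E, (∀ x ∈ W, T x ∈ W) → W = ⊥ ∨ W = ⊤) {e : E} (he : e ≠ 0) :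
    cyclicFlag (O := K) T e (Module.finrank K E) = ⊤ := by
  have key : ∀ i, cyclicFlag (O := K) T e i = ⊤ ∨
      i ≤ Module.finrank K (cyclicFlag (O := K) T e i) := by
    intro i
    induction i with
    | zero => exact .inr (Nat.zero_le _)
    | succ i ih =>
      rcases ih with h | h
      · exact .inl (top_le_iff.1 (h ▸ cyclicFlag_mono T e (Nat.le_succ i)))
      by_cases heq : cyclicFlag (O := K) T e (i + 1) = cyclicFlag (O := K) T e i
      · rcases hirr (cyclicFlag (O := K) T e (i + 1)) fun x hx =>
          map_mem_cyclicFlag hT e (heq ▸ hx) with h' | h'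
        · have := iterate_mem_cyclicFlag (O := K) T e (Nat.succ_pos i)
          rw [h'] at this
          exact absurd this he
        · exact .inl h'
      · exact .inr (Nat.succ_le_of_lt (h.trans_lt (Submodule.finrank_lt_finrank_of_lt
          (lt_of_le_of_ne (cyclicFlag_mono T e (Nat.le_succ i)) (Ne.symm heq)))))
  rcases key (Module.finrank K E) with h | h
  · exact h
  · exact Submodule.eq_top_of_finrank_eq (le_antisymm (Submodule.finrank_le _) h)

end Cyclic

/-! ### Smooth curves, and irreducibility at the generic point. -/

section Curve

/-- Nullstellensatz: the residue field is finite over the algebraically closed field `k`, hence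
equal to it. -/
theorem exists_algHom_ker_eq {k A : Type*} [Field k] [IsAlgClosed k] [CommRing A] [Algebra k A]
    [Algebra.FiniteType k A] (m : Ideal A) [hm : m.IsMaximal] :
    ∃ s : A →ₐ[k] k, RingHom.ker s = m := by
  let _ : Field (A ⧸ m) := Ideal.Quotient.field m
  have : Module.Finite k (A ⧸ m) := finite_of_finite_type_of_isJacobsonRing k (A ⧸ m)
  have hbij : Function.Bijective (Algebra.ofId k (A ⧸ m)) :=
    IsAlgClosed.algebraMap_bijective_of_isIntegral
  refine ⟨(AlgEquiv.ofBijective _ hbij).symm.toAlgHom.comp (Ideal.Quotient.mkₐ k m), ?_⟩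
  ext a
  simp [RingHom.mem_ker, Ideal.Quotient.eq_zero_iff_mem]

variable {k R : Type*} [Field k] [CommRing R] [IsDomain R] [Algebra k R]

/-- Sending `f` to the class of `f - f(x)` in `m/m²` is a derivation which is the quotient map on
`m`. It factors through `Ω[O⁄k]`, a module with one generator, so `m/m²` has dimension at most one
and Nakayama makes `m` principal. -/
theorem isPrincipal_maximalIdeal_of_rational {O : Type*} [CommRing O] [IsLocalRing O]
    [IsNoetherianRing O] [Algebra k O] (ev : O →ₐ[k] k) (e : O ≃ₗ[O] Ω[O⁄k]) :
    (IsLocalRing.maximalIdeal O).IsPrincipal := by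
  have hsurj : Function.Surjective ev := fun c => ⟨algebraMap k O c, ev.commutes c⟩
  have hker : ∀ f, ev f = 0 ↔ f ∈ IsLocalRing.maximalIdeal O := by
    intro f
    rw [← IsLocalRing.eq_maximalIdeal (RingHom.ker_isMaximal_of_surjective ev hsurj),
      RingHom.mem_ker]
  have hsub : ∀ f, f - algebraMap k O (ev f) ∈ IsLocalRing.maximalIdeal O := fun f => by
    simp [← hker]
  let δ₀ : O →ₗ[k] (IsLocalRing.maximalIdeal O).Cotangent :=
    { toFun f := (IsLocalRing.maximalIdeal O).toCotangent ⟨f - algebraMap k O (ev f), hsub f⟩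
      map_add' f g := by
        rw [← map_add]
        congr 1
        ext
        simp only [map_add, Submodule.coe_add]
        ring
      map_smul' c f := by
        rw [RingHom.id_apply, ← algebraMap_smul O c ((IsLocalRing.maximalIdeal O).toCotangent _),
          ← map_smul]
        congr 1
        ext
        simp only [Algebra.smul_def, map_mul, AlgHom.commutes, SetLike.val_smul,
          Algebra.algebraMap_self, RingHom.id_apply]
        ring }
  let δ : Derivation k O (IsLocalRing.maximalIdeal O).Cotangent := Derivation.mk' δ₀ fun f g => by
    simp only [δ₀, LinearMap.coe_mk, AddHom.coe_mk]
    rw [← map_smul, ← map_smul, ← map_add, Ideal.toCotangent_eq]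
    -- The failure of the Leibniz rule is `-(f - f(x)) (g - g(x))`, an element of `m²`.
    have : f * g - algebraMap k O (ev (f * g)) -
        (f * (g - algebraMap k O (ev g)) + g * (f - algebraMap k O (ev f))) =
        -((f - algebraMap k O (ev f)) * (g - algebraMap k O (ev g))) := by
      rw [map_mul, map_mul]; ring
    simp only [Submodule.coe_add, SetLike.val_smul, smul_eq_mul, this]
    exact neg_mem (pow_two (IsLocalRing.maximalIdeal O) ▸ Ideal.mul_mem_mul (hsub f) (hsub g))
  rw [← IsLocalRing.finrank_cotangentSpace_le_one_iff]
  refine finrank_le_one (δ.liftKaehlerDifferential (e 1)) fun x => ?_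
  obtain ⟨g, rfl⟩ := Ideal.toCotangent_surjective _ x
  obtain ⟨a, ha⟩ := e.surjective (D k O (g : O))
  refine ⟨IsLocalRing.residue O a, ?_⟩
  have h1 : δ (g : O) = (IsLocalRing.maximalIdeal O).toCotangent g := by
    change (IsLocalRing.maximalIdeal O).toCotangent ⟨g - algebraMap k O (ev g), hsub g⟩ = _
    congr 1
    ext
    simp [(hker g).2 g.2]
  have h2 : a • δ.liftKaehlerDifferential (e 1) = δ (g : O) := by
    rw [← map_smul, ← map_smul, smul_eq_mul, mul_one, ha, Derivation.liftKaehlerDifferential_comp_D]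
  rw [← h1, ← h2]
  exact algebraMap_smul (IsLocalRing.ResidueField O) a _

theorem valuationRing_localization [IsAlgClosed k] [Algebra.FiniteType k R]
    [Module.Projective R Ω[R⁄k]]
    (hX : ∀ x : PrimeSpectrum R, Module.rankAtStalk Ω[R⁄k] x = 1) (P : Ideal R) [P.IsMaximal] :
    ValuationRing (Localization.AtPrime P) := by
  have : IsNoetherianRing R := Algebra.FiniteType.isNoetherianRing k R
  have : IsNoetherianRing (Localization.AtPrime P) :=
    IsLocalization.isNoetherianRing P.primeCompl _ inferInstance
  have : Algebra.FormallyEtale R (Localization.AtPrime P) :=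
    Algebra.FormallyEtale.of_isLocalization P.primeCompl
  obtain ⟨e⟩ := nonempty_equiv_kaehler hX
    (KaehlerDifferential.isBaseChange_of_formallyEtale k R (Localization.AtPrime P))
  obtain ⟨s, hs⟩ := exists_algHom_ker_eq (k := k) P
  let ev : Localization.AtPrime P →ₐ[k] k := IsLocalization.liftAlgHom (M := P.primeCompl) (f := s)
    fun y => isUnit_iff_ne_zero.2 fun h => y.2 (hs ▸ h)
  -- Entry 4 of the list is that the maximal ideal is principal, entry 1 that the ring is a
  -- valuation ring.
  exact ((tfae_of_isNoetherianRing_of_isLocalRing_of_isDomain (Localization.AtPrime P)).out 4 1).1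
    (isPrincipal_maximalIdeal_of_rational ev e)

/-- Over a domain whose localizations at maximal ideals are valuation rings, torsion-free means
flat; a finitely presented flat module is projective. This shows that saturated subsheaves on the
curve are sub-bundles. -/
theorem projective_of_torsion_eq_bot [IsAlgClosed k] [Algebra.FiniteType k R]
    [Module.Projective R Ω[R⁄k]]
    (hX : ∀ x : PrimeSpectrum R, Module.rankAtStalk Ω[R⁄k] x = 1)
    {Q : Type*} [AddCommGroup Q] [Module R Q] [Module.Finite R Q]
    (hQ : Submodule.torsion R Q = ⊥) : Module.Projective R Q := by
  have : IsNoetherianRing R := Algebra.FiniteType.isNoetherianRing k R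
  have : Module.FinitePresentation R Q := Module.finitePresentation_of_finite R Q
  have : Module.Flat R Q :=
    (Module.Flat.flat_iff_torsion_eq_bot_of_valuationRing_localization_isMaximal
      fun P _ => valuationRing_localization hX P).2 hQ
  exact Module.Flat.projective_of_finitePresentation

variable {M : Type*} [AddCommGroup M] [Module R M] [Module.Finite R M]

/-- An irreducible connection on the curve remains irreducible at the generic point. -/
theorem Connection.IsIrreducible.eq_bot_or_eq_top [IsAlgClosed k] [Algebra.FiniteType k R]
    [Module.Projective R Ω[R⁄k]]
    (hX : ∀ x : PrimeSpectrum R, Module.rankAtStalk Ω[R⁄k] x = 1)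
    {N : Connection k R M} (hN : N.IsIrreducible)
    {K : Type*} [Field K] [Algebra R K] [IsFractionRing R K] [Algebra k K] [IsScalarTower k R K]
    (hK : IsBaseChange K (KaehlerDifferential.map k k R K)) {θ : Ω[R⁄k] →ₗ[R] R}
    (hθ : Function.Injective θ) (W : Submodule K (K ⊗[R] M))
    (hW : ∀ x ∈ W, N.along (liftForm hK θ) x ∈ W) : W = ⊥ ∨ W = ⊤ := by
  -- The sections of `E` whose generic germ lies in `W`. The quotient by `P` is torsion-free because
  -- nonzero scalars can be divided out in `W`.
  let P : Submodule R M := (W.restrictScalars R).comap (TensorProduct.mk R K M 1)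
  have hP : ∀ m, m ∈ P ↔ (1 : K) ⊗ₜ[R] m ∈ W := fun m => Iff.rfl
  have hmem : ∀ (a : R) (x : K ⊗[R] M), a ∈ nonZeroDivisors R → a • x ∈ W → x ∈ W := by
    intro a x ha hx
    have ha' : algebraMap R K a ≠ 0 := by
      simpa using nonZeroDivisors.ne_zero ha
    rw [← algebraMap_smul K a x] at hx
    have := W.smul_mem (algebraMap R K a)⁻¹ hx
    rwa [smul_smul, inv_mul_cancel₀ ha', one_smul] at this
  have hproj : Module.Projective R (M ⧸ P) := by
    refine projective_of_torsion_eq_bot hX (eq_bot_iff.2 ?_)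
    rintro x ⟨a, ha⟩
    obtain ⟨m, rfl⟩ := P.mkQ_surjective x
    change (a : R) • P.mkQ m = 0 at ha
    rw [← map_smul, Submodule.mkQ_apply, Submodule.Quotient.mk_eq_zero, hP,
      TensorProduct.tmul_smul] at ha
    rw [Submodule.mem_bot, Submodule.mkQ_apply, Submodule.Quotient.mk_eq_zero]
    exact hmem a _ a.2 ha
  have hstable : ∀ v ∈ P, N.toFun v ∈ LinearMap.range (P.subtype.lTensor Ω[R⁄k]) := by
    intro v hv
    -- Membership in `ω ⊗ P` is tested in `ω ⊗ (M ⧸ P)`. There contraction with `θ` is injective,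
    -- since `M ⧸ P` is flat, and the contraction of `∇ v` lies in `P` because `W` is stable.
    refine (lTensor_exact Ω[R⁄k] (LinearMap.exact_subtype_mkQ P) P.mkQ_surjective _).1 ?_
    have hinj : Function.Injective (contractForm θ : Ω[R⁄k] ⊗[R] (M ⧸ P) →ₗ[R] M ⧸ P) :=
      (TensorProduct.lid R (M ⧸ P)).injective.comp
        (Module.Flat.rTensor_preserves_injective_linearMap θ hθ)
    apply hinj
    have hcomm : ∀ z : Ω[R⁄k] ⊗[R] M,
        contractForm θ (P.mkQ.lTensor Ω[R⁄k] z) = P.mkQ (contractForm θ z) := by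
      intro z
      induction z with
      | zero => simp
      | tmul w m => simp
      | add x y hx hy => simp only [map_add, hx, hy]
    rw [hcomm, map_zero, Submodule.mkQ_apply, Submodule.Quotient.mk_eq_zero, hP,
      ← N.along_one_tmul hK]
    exact hW _ hv
  have hloc : IsLocalizedModule (nonZeroDivisors R) (TensorProduct.mk R K M 1) :=
    (isLocalizedModule_iff_isBaseChange (nonZeroDivisors R) K _).2
      (TensorProduct.isBaseChange R M K)
  -- Clearing denominators: `W` is recovered from `P`, so `P = 0` gives `W = 0` and `P = E` gives `W
  -- = ⊤`.
  have hsurj : ∀ x : K ⊗[R] M, ∃ a ∈ nonZeroDivisors R, ∃ m : M, a • x = (1 : K) ⊗ₜ[R] m := by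
    intro x
    obtain ⟨⟨m, a⟩, h⟩ := IsLocalizedModule.surj (nonZeroDivisors R) (TensorProduct.mk R K M 1) x
    exact ⟨a, a.2, m, h⟩
  rcases hN.2 P hproj hstable with h | h
  · refine .inl (eq_bot_iff.2 fun x hx => ?_)
    obtain ⟨a, ha, m, hm⟩ := hsurj x
    have : m ∈ P := by
      rw [hP, ← hm, ← algebraMap_smul K a x]
      exact W.smul_mem _ hx
    rw [h, Submodule.mem_bot] at this
    rw [this, TensorProduct.tmul_zero, ← algebraMap_smul K a x] at hm
    exact (smul_eq_zero.1 hm).resolve_left (by simpa using nonZeroDivisors.ne_zero ha)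
  · refine .inr (eq_top_iff.2 fun x _ => ?_)
    obtain ⟨a, ha, m, hm⟩ := hsurj x
    refine hmem a x ha ?_
    rw [hm, ← hP, h]
    trivial

/-- There is a vector field on the curve which does not vanish identically. -/
theorem exists_form_injective [Module.Finite R Ω[R⁄k]] [Module.Projective R Ω[R⁄k]]
    (hX : ∀ x : PrimeSpectrum R, Module.rankAtStalk Ω[R⁄k] x = 1) :
    ∃ (θ : Ω[R⁄k] →ₗ[R] R) (w : Ω[R⁄k]), θ w ≠ 0 ∧ Function.Injective θ := by
  have : Nontrivial Ω[R⁄k] := Module.nontrivial_of_rankAtStalk_pos (R := R)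
    (by rw [show Module.rankAtStalk Ω[R⁄k] = 1 from funext hX]; exact one_pos)
  obtain ⟨w, hw⟩ := exists_ne (0 : Ω[R⁄k])
  obtain ⟨θ, hθ⟩ : ∃ θ : Module.Dual R Ω[R⁄k], θ w ≠ 0 := by
    by_contra! h
    exact hw ((Module.forall_dual_apply_eq_zero_iff R w).1 h)
  refine ⟨θ, w, hθ, ?_⟩
  have : Algebra.FormallyEtale R (FractionRing R) :=
    Algebra.FormallyEtale.of_isLocalization (nonZeroDivisors R)
  have hK := KaehlerDifferential.isBaseChange_of_formallyEtale k R (FractionRing R)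
  -- Over the function field a nonzero form on a line is bijective. Since `Ω[R⁄k]` is torsion-free
  -- it embeds in its generic fibre, so `θ` is already injective.
  have hbij := liftForm_bijective hX hK θ w (by simpa using hθ)
  have hinj : Function.Injective (KaehlerDifferential.map k k R (FractionRing R)) := by
    have : IsLocalizedModule (nonZeroDivisors R)
        (KaehlerDifferential.map k k R (FractionRing R)) :=
      (isLocalizedModule_iff_isBaseChange (nonZeroDivisors R) (FractionRing R) _).2 hK
    refine (IsLocalizedModule.injective_iff_isRegular (nonZeroDivisors R) _).2 fun c => ?_
    exact Module.IsTorsionFree.isSMulRegular (isRegular_iff_mem_nonZeroDivisors.2 c.2)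
  intro x y hxy
  apply hinj
  apply hbij.1
  rw [liftForm_map, liftForm_map, hxy]

end Curve

/-! ### Lifting frames from a residue field. -/

section LocalFrames

variable {R M : Type*} [CommRing R] [AddCommGroup M] [Module R M]

theorem repr_eMap {O O' : Type*} [CommRing O] [CommRing O'] [Algebra R O] [Algebra R O']
    (ψ : O →ₐ[R] O') {ι : Type*} [Fintype ι] (b : Module.Basis ι O (O ⊗[R] M))
    {b' : Module.Basis ι O' (O' ⊗[R] M)} (hb : ∀ i, b' i = eMap ψ (b i)) (x : O ⊗[R] M) (i : ι) :
    b'.repr (eMap ψ x) i = ψ (b.repr x i) := by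
  classical
  have : eMap ψ x = ∑ j, ψ (b.repr x j) • b' j := by
    conv_lhs => rw [← b.sum_repr x]
    simp only [map_sum, eMap_smul, hb]
  rw [this, b'.repr_sum_self]

/-- A family of vectors of a free module over a local ring spans if it does so at the residue
field. -/
theorem span_eq_top_of_span_eMap_eq_top {O K : Type*} [CommRing O] [IsLocalRing O] [Field K]
    [Algebra R O] [Algebra R K] (ψ : O →ₐ[R] K) (hψ : ∀ f ∈ IsLocalRing.maximalIdeal O, ψ f = 0)
    {ι : Type*} [Fintype ι] (b : Module.Basis ι O (O ⊗[R] M)) (v : ι → O ⊗[R] M)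
    (hv : Submodule.span K (Set.range fun i => eMap ψ (v i)) = ⊤) :
    Submodule.span O (Set.range v) = ⊤ := by
  classical
  obtain ⟨b', hb'⟩ := isBasis_eMap ψ b
  -- The determinant of `v` in the basis `b` maps to that of its image over `K`, which is nonzero.
  -- As `ψ` kills the maximal ideal, the determinant over `O` is a unit.
  have hdet : b'.det (fun i => eMap ψ (v i)) = ψ (b.det v) := by
    rw [Module.Basis.det_apply, Module.Basis.det_apply, AlgHom.map_det]
    congr 1
    ext i j
    simp [Module.Basis.toMatrix_apply, repr_eMap ψ b hb']
  have hunit : IsUnit (b'.det fun i => eMap ψ (v i)) :=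
    (Module.Basis.is_basis_iff_det b').1 ⟨linearIndependent_of_top_le_span_of_card_eq_finrank hv.ge
      (Module.finrank_eq_card_basis b').symm, hv⟩
  refine ((Module.Basis.is_basis_iff_det b).2 ?_).2
  by_contra h
  rw [hdet, hψ _ ((IsLocalRing.mem_maximalIdeal _).2 h)] at hunit
  exact not_isUnit_zero hunit

end LocalFrames

/-! ### Spreading out on `S × X`, and a criterion for domains. -/

section Geometry

open TopologicalSpace

attribute [local instance] Algebra.TensorProduct.rightAlgebra

variable {k R M : Type u} [Field k] [CommRing R] [Algebra k R] [AddCommGroup M] [Module R M]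
  {A : Type u} [CommRing A] [Algebra k A]

theorem finrank_eStalk [Module.Finite R M] [Module.Projective R M] {n : ℕ}
    (hn : ∀ x : PrimeSpectrum R, Module.rankAtStalk M x = n) (q : PrimeSpectrum (A ⊗[k] R)) :
    Module.Free (Stalk q) (EStalk M q) ∧ Module.finrank (Stalk q) (EStalk M q) = n := by
  have : Module.Free (Stalk q) (EStalk M q) := Module.free_of_flat_of_isLocalRing
  have h1 := Module.rankAtStalk_baseChange (R := R) (M := M) (IsLocalRing.closedPoint (Stalk q))
  rw [hn, Module.rankAtStalk_eq_finrank_of_free] at h1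
  exact ⟨this, by simpa using h1⟩

theorem germ_smul (q : PrimeSpectrum (A ⊗[k] R)) (c : A ⊗[k] R) (x : (A ⊗[k] R) ⊗[R] M) :
    germ q (c • x) = algebraMap (A ⊗[k] R) (Stalk q) c • germ q x := eMap_smul _ _ _

theorem span_range_germ (q : PrimeSpectrum (A ⊗[k] R)) :
    Submodule.span (Stalk q) (Set.range (germ q : (A ⊗[k] R) ⊗[R] M → EStalk M q)) = ⊤ := by
  refine eq_top_iff.2 fun x _ => ?_
  induction x using TensorProduct.induction_on with
  | zero => exact zero_mem _
  | tmul f m =>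
    have : f ⊗ₜ[R] m = f • germ q ((1 : A ⊗[k] R) ⊗ₜ[R] m) := by
      simp [germ, eMap, TensorProduct.smul_tmul']
    rw [this]
    exact Submodule.smul_mem _ _ (Submodule.subset_span ⟨_, rfl⟩)
  | add x y hx hy => exact add_mem (hx trivial) (hy trivial)

theorem isUnit_algebraMap_stalk (q : PrimeSpectrum (A ⊗[k] R)) {c : A ⊗[k] R}
    (hc : c ∉ q.asIdeal) : IsUnit (algebraMap (A ⊗[k] R) (Stalk q) c) :=
  IsLocalization.map_units (M := q.asIdeal.primeCompl) (Stalk q) ⟨c, hc⟩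

/-- Sections that generate the pull-back of `E` at a point do so in a neighbourhood. -/
theorem exists_open_span_germ_eq_top [Module.Finite R M] {ι : Type*}
    (x : ι → (A ⊗[k] R) ⊗[R] M) (p : PrimeSpectrum (A ⊗[k] R))
    (hp : Submodule.span (Stalk p) (Set.range fun i => germ p (x i)) = ⊤) :
    ∃ W : Opens (PrimeSpectrum (A ⊗[k] R)), p ∈ W ∧
      ∀ q ∈ W, Submodule.span (Stalk q) (Set.range fun i => germ q (x i)) = ⊤ := by
  -- The germs generate at every point outside the support of the quotient by `Q`. This quotient is
  -- a finite module, so its support is closed.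
  let Q := Submodule.span (A ⊗[k] R) (Set.range x)
  have hsupp : p ∉ Module.support (A ⊗[k] R) ((A ⊗[k] R) ⊗[R] M ⧸ Q) := by
    rw [Module.notMem_support_iff']
    intro y
    obtain ⟨y, rfl⟩ := Q.mkQ_surjective y
    have hloc : IsLocalizedModule p.asIdeal.primeCompl
        (eMapO (A ⊗[k] R) (Stalk p) : (A ⊗[k] R) ⊗[R] M →ₗ[A ⊗[k] R] EStalk M p) :=
      (isLocalizedModule_iff_isBaseChange p.asIdeal.primeCompl (Stalk p) _).2
        (isBaseChange_eMapO _ _)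
    have hrange : (eMapO (A ⊗[k] R) (Stalk p) : (A ⊗[k] R) ⊗[R] M → EStalk M p) '' Set.range x =
        Set.range fun i => germ p (x i) := by
      rw [← Set.range_comp]
      congr 1
    have hy : eMapO (A ⊗[k] R) (Stalk p) y ∈
        Q.localized' (Stalk p) p.asIdeal.primeCompl (eMapO (A ⊗[k] R) (Stalk p)) := by
      rw [Submodule.localized'_span, hrange, hp]
      trivial
    rw [Submodule.mem_localized'] at hy
    obtain ⟨z, hz, t, hzt⟩ := hy
    rw [IsLocalizedModule.mk'_eq_iff, Submonoid.smul_def, ← map_smul,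
      IsLocalizedModule.eq_iff_exists p.asIdeal.primeCompl] at hzt
    obtain ⟨t', ht'⟩ := hzt
    refine ⟨t' * t, (t' * t).2, ?_⟩
    rw [← map_smul, Submodule.mkQ_apply, Submodule.Quotient.mk_eq_zero, mul_smul]
    have : (t' : A ⊗[k] R) • (t : A ⊗[k] R) • y = (t' : A ⊗[k] R) • z := ht'.symm
    rw [this]
    exact Q.smul_mem _ hz
  refine ⟨⟨(Module.support (A ⊗[k] R) ((A ⊗[k] R) ⊗[R] M ⧸ Q))ᶜ, ?_⟩, hsupp, fun q hq => ?_⟩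
  · rw [Module.support_eq_zeroLocus]
    exact (PrimeSpectrum.isClosed_zeroLocus _).isOpen_compl
  · rw [eq_top_iff, ← span_range_germ, Submodule.span_le]
    rintro _ ⟨y, rfl⟩
    obtain ⟨t, ht, hty⟩ := Module.notMem_support_iff'.1 hq (Q.mkQ y)
    rw [← map_smul, Submodule.mkQ_apply, Submodule.Quotient.mk_eq_zero] at hty
    have h1 : germ q (t • y) ∈ Submodule.span (Stalk q) (Set.range fun i => germ q (x i)) := by
      have := spanMap_span (IsScalarTower.toAlgHom R (A ⊗[k] R) (Stalk q)) (Set.range x)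
      rw [← Set.range_comp] at this
      change _ ∈ Submodule.span (Stalk q) (Set.range (germ q ∘ x))
      rw [germ, ← this]
      exact Submodule.subset_span ⟨_, hty, rfl⟩
    rw [germ_smul] at h1
    obtain ⟨u, hu⟩ := isUnit_algebraMap_stalk q ht
    rw [← hu] at h1
    simpa [smul_smul] using Submodule.smul_mem _ (↑u⁻¹ : Stalk q) h1

/-! ### Generic points of closed fibres -/

variable (R) in
/-- Restriction of functions on `S × X` to the fibre over the `k`-point `s` of `S`. -/
def fibreHom (s : A →ₐ[k] k) : A ⊗[k] R →ₐ[R] R :=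
  { (Algebra.TensorProduct.productMap ((Algebra.ofId k R).comp s) (AlgHom.id k R)).toRingHom with
    commutes' := fun r => by simp [Algebra.TensorProduct.right_algebraMap_apply] }

theorem fibreHom_tmul (s : A →ₐ[k] k) (a : A) (r : R) :
    fibreHom R s (a ⊗ₜ r) = algebraMap k R (s a) * r := by
  change Algebra.TensorProduct.productMap ((Algebra.ofId k R).comp s) (AlgHom.id k R) _ = _
  simp [Algebra.ofId_apply]

theorem fibreHom_algebraMap (s : A →ₐ[k] k) (a : A) :
    fibreHom R s (algebraMap A (A ⊗[k] R) a) = algebraMap k R (s a) := by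
  rw [Algebra.TensorProduct.algebraMap_apply, fibreHom_tmul, mul_one]
  rfl

/-- Modulo `ker s`, a function on `S × X` is its own restriction to the fibre over `s`. Hence a
function vanishing on that fibre vanishes at each of its points. -/
theorem sub_fibreHom_mem (s : A →ₐ[k] k) {p : PrimeSpectrum (A ⊗[k] R)}
    (hp : RingHom.ker s ≤ (PrimeSpectrum.comap (algebraMap A (A ⊗[k] R)) p).asIdeal)
    (x : A ⊗[k] R) : x - algebraMap R (A ⊗[k] R) (fibreHom R s x) ∈ p.asIdeal := by
  induction x with
  | zero => simp
  | tmul a r =>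
    have h1 : a - algebraMap k A (s a) ∈ RingHom.ker s := by simp [RingHom.mem_ker]
    have h2 : algebraMap A (A ⊗[k] R) (a - algebraMap k A (s a)) ∈ p.asIdeal := hp h1
    have h3 := p.asIdeal.mul_mem_right (algebraMap R (A ⊗[k] R) r) h2
    have h4 : algebraMap A (A ⊗[k] R) (algebraMap k A (s a)) =
        algebraMap R (A ⊗[k] R) (algebraMap k R (s a)) := by
      rw [← IsScalarTower.algebraMap_apply, ← IsScalarTower.algebraMap_apply]
    have h5 : a ⊗ₜ[k] r = algebraMap A (A ⊗[k] R) a * algebraMap R (A ⊗[k] R) r := by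
      simp [Algebra.TensorProduct.algebraMap_apply, Algebra.TensorProduct.right_algebraMap_apply]
    rw [fibreHom_tmul, h5]
    rwa [map_sub, h4, sub_mul, ← map_mul] at h3
  | add x y hx hy =>
    have := add_mem hx hy
    rw [map_add, map_add]
    convert! this using 1
    abel

variable [IsDomain R]

variable (R) in
/-- The generic point of the fibre over the `k`-point `s` of `S`. -/
def fibreGenericPoint (s : A →ₐ[k] k) : PrimeSpectrum (A ⊗[k] R) :=
  PrimeSpectrum.comap (fibreHom R s).toRingHom ⊥

theorem mem_fibreGenericPoint (s : A →ₐ[k] k) (x : A ⊗[k] R) :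
    x ∈ (fibreGenericPoint R s).asIdeal ↔ fibreHom R s x = 0 := Iff.rfl

theorem comap_fibreGenericPoint (s : A →ₐ[k] k) :
    (PrimeSpectrum.comap (algebraMap A (A ⊗[k] R)) (fibreGenericPoint R s)).asIdeal =
      RingHom.ker s := by
  ext a
  change algebraMap A (A ⊗[k] R) a ∈ (fibreGenericPoint R s).asIdeal ↔ _
  rw [mem_fibreGenericPoint, fibreHom_algebraMap, RingHom.mem_ker,
    map_eq_zero_iff _ (algebraMap k R).injective]

/-- A domain meets the fibre over `s`. That fibre is a copy of the irreducible curve `X`, so its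
generic point specializes to the point met, and open sets are stable under generization. -/
theorem Dom.fibreGenericPoint_mem (U : Dom k R A) (s : A →ₐ[k] k) :
    fibreGenericPoint R s ∈ U.carrier := by
  have hker : (RingHom.ker s).IsPrime := RingHom.ker_isPrime s
  obtain ⟨p, hp, hps⟩ := U.surj ⟨RingHom.ker s, hker⟩
  refine ((PrimeSpectrum.le_iff_specializes _ p).1 fun x hx => ?_).mem_open U.carrier.isOpen hp
  have := sub_fibreHom_mem s (p := p) (by rw [hps]) x
  rwa [(mem_fibreGenericPoint s x).1 hx, map_zero, sub_zero] at this

variable [IsAlgClosed k] [Algebra.FiniteType k A]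

/-- An open subset of `S × X` which contains the generic points of the closed fibres is a
domain. -/
def Dom.ofFibreGenericPoint (W : Opens (PrimeSpectrum (A ⊗[k] R)))
    (hW : ∀ s : A →ₐ[k] k, fibreGenericPoint R s ∈ W) : Dom k R A where
  carrier := W
  surj t := by
    -- The point `t` specializes to a closed point, which is a `k`-point and lies in the image of
    -- `W`. The projection to `S` is open, so the image contains `t` as well.
    obtain ⟨m, hm, htm⟩ := Ideal.exists_le_maximal t.asIdeal t.2.ne_top
    obtain ⟨s, hs⟩ := exists_algHom_ker_eq (k := k) m
    have hopen := PrimeSpectrum.isOpenMap_comap_algebraMap_tensorProduct_of_field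
      (K := k) (A := A) (B := R) W W.isOpen
    have hmem : (⟨m, hm.isPrime⟩ : PrimeSpectrum A) ∈
        PrimeSpectrum.comap (algebraMap A (A ⊗[k] R)) '' W :=
      ⟨_, hW s, PrimeSpectrum.ext ((comap_fibreGenericPoint s).trans hs)⟩
    exact ((PrimeSpectrum.le_iff_specializes t _).1 htm).mem_open hopen hmem

/-- Transitivity needs the intersection of two domains to be a domain, which holds because each
contains the generic points of all closed fibres. Consequently, equality in the colimit means
agreement on a sub-domain. -/
theorem FamilyCondition.Sect.Rel.equivalence {ι : Type} (C : FamilyCondition k R M ι) :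
    Equivalence (Sect.Rel (C := C) (A := A)) where
  refl x := ⟨x.dom, le_rfl, le_rfl, fun _ => rfl⟩
  symm := fun ⟨V, hx, hy, H⟩ => ⟨V, hy, hx, fun i => (H i).symm⟩
  trans := by
    rintro x y z ⟨V, hx, hy, H⟩ ⟨V', hy', hz, H'⟩
    refine ⟨Dom.ofFibreGenericPoint (V.carrier ⊓ V'.carrier) fun s =>
      ⟨V.fibreGenericPoint_mem s, V'.fibreGenericPoint_mem s⟩, inf_le_left.trans hx,
      inf_le_right.trans hz, fun i => funext fun p => ?_⟩
    exact (congrFun (H i) ⟨p.1, p.2.1⟩).trans (congrFun (H' i) ⟨p.1, p.2.2⟩)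

end Geometry

/-! ### Partial opers and their lines. -/

section Geometry

open TopologicalSpace

attribute [local instance] Algebra.TensorProduct.rightAlgebra

variable {k R M : Type u} [Field k] [CommRing R] [Algebra k R] [AddCommGroup M]
  [Module R M] {A : Type u} [CommRing A] [Algebra k A]

variable (A) in
/-- Differentiation of sections of the pull-back of `E` to `S × X` along a vector field on `X`. -/
def Connection.alongProd (N : Connection k R M) (θ : Ω[R⁄k] →ₗ[R] R) :
    (A ⊗[k] R) ⊗[R] M →+ (A ⊗[k] R) ⊗[R] M :=
  N.along (liftForm (isBaseChange_kaehler_prod (A := A)) θ)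

/-- Differentiation of germs of sections of the pull-back of `E` along a vector field on `X`. -/
def Connection.alongStalk (N : Connection k R M) (θ : Ω[R⁄k] →ₗ[R] R)
    (q : PrimeSpectrum (A ⊗[k] R)) : EStalk M q →+ EStalk M q :=
  N.along (liftForm (isBaseChange_kaehler_stalk q) θ)

/-- The derivatives of a germ of a section are germs of sections on all of `S × X`, so that a
condition on them at one point can be spread to a neighbourhood. -/
theorem germ_iterate_alongProd (N : Connection k R M) (θ : Ω[R⁄k] →ₗ[R] R)
    (q : PrimeSpectrum (A ⊗[k] R)) (j : ℕ) (x : (A ⊗[k] R) ⊗[R] M) :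
    germ q ((N.alongProd A θ)^[j] x) = (N.alongStalk θ q)^[j] (germ q x) :=
  eMap_iterate_along (AlgHom.id k A) (IsScalarTower.toAlgHom R (A ⊗[k] R) (Stalk q))
    (fun a => (IsScalarTower.algebraMap_apply A (A ⊗[k] R) (Stalk q) a).symm) N
    isBaseChange_kaehler_prod (isBaseChange_kaehler_stalk q) θ j x

/-- The flag generated by a line is a partial oper wherever the line is locally generated by
cyclic sections and the vector field does not vanish. -/
theorem isPartialOper_derivedFlag [Module.Finite R Ω[R⁄k]] [Module.Projective R Ω[R⁄k]]
    [Module.Finite R M] [Module.Projective R M]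
    (hX : ∀ x : PrimeSpectrum R, Module.rankAtStalk Ω[R⁄k] x = 1) {n : ℕ}
    (hn : ∀ x : PrimeSpectrum R, Module.rankAtStalk M x = n) (N : Connection k R M)
    (θ : Ω[R⁄k] →ₗ[R] R) (w : Ω[R⁄k]) {r : ℕ} (hr : r ≤ n)
    {U : Opens (PrimeSpectrum (A ⊗[k] R))} {F : Family M U}
    (hw : ∀ q : U, algebraMap R (A ⊗[k] R) (θ w) ∉ q.1.asIdeal)
    (hF : ∀ p : U, ∃ W : Opens (PrimeSpectrum (A ⊗[k] R)), p.1 ∈ W ∧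
      ∃ e : (A ⊗[k] R) ⊗[R] M, ∀ q : U, q.1 ∈ W →
        F q = Submodule.span (Stalk q.1) {germ q.1 e} ∧
        Submodule.span (Stalk q.1)
          (Set.range fun j : Fin n => germ q.1 ((N.alongProd A θ)^[j] e)) = ⊤) :
    IsPartialOper N r fun (i : Fin (r + 1)) (q : U) =>
      derivedFlag (N.alongStalk θ q.1) (F q) i := by
  have hbij : ∀ q : U, Function.Bijective (liftForm (isBaseChange_kaehler_stalk q.1) θ) := by
    intro q
    refine liftForm_bijective hX _ θ w ?_
    rw [IsScalarTower.algebraMap_apply R (A ⊗[k] R) (Stalk q.1)]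
    exact isUnit_algebraMap_stalk q.1 (hw q)
  have hflag : ∀ (q : U) (e : (A ⊗[k] R) ⊗[R] M), F q = Submodule.span (Stalk q.1) {germ q.1 e} →
      ∀ i, derivedFlag (N.alongStalk θ q.1) (F q) i =
        cyclicFlag (N.alongStalk θ q.1) (germ q.1 e) i := fun q e he i => by
    rw [he, derivedFlag_span_singleton (N.along_smul _)]
  constructor
  · intro i p
    obtain ⟨W, hW, e, H⟩ := hF p
    -- The derivatives of order below `i` generate `F_i`; those of order `i, …, n - 1` complete them
    -- to a frame of `E`.
    refine ⟨W, hW, n - i, fun x => (N.alongProd A θ)^[x] e,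
      fun x => (N.alongProd A θ)^[i + x] e, fun q hq => ⟨?_, ?_⟩⟩
    · obtain ⟨hfree, hrank⟩ := finrank_eStalk hn q.1
      let b := basisOfTopLeSpanOfCardEqFinrank _ (H q hq).2.ge (by simpa using hrank.symm)
      have hb : ∀ x, b x = germ q.1 ((N.alongProd A θ)^[x] e) := fun x => by
        simp [b, coe_basisOfTopLeSpanOfCardEqFinrank]
      refine ⟨b.reindex ((finCongr (by have := i.2; omega)).trans finSumFinEquiv.symm),
        fun x => ?_⟩
      rw [Module.Basis.reindex_apply, hb]
      cases x <;> simp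
    · change derivedFlag (N.alongStalk θ q.1) (F q) i = _
      rw [hflag q e (H q hq).1, cyclicFlag]
      simp only [germ_iterate_alongProd]
  all_goals
    intro i hi q
    obtain ⟨W, hW, e, H⟩ := hF q
    obtain ⟨he, hspan⟩ := H q hW
  · rw [hflag q e he, hflag q e he]
    exact cyclicFlag_mono _ _ (Nat.le_succ i)
  · rw [hflag q e he, hflag q e he, N.mapsInto_iff (hbij q)]
    exact fun v hv => map_mem_cyclicFlag (N.along_smul _) _ hv
  · obtain ⟨hfree, hrank⟩ := finrank_eStalk (M := M) hn q.1
    have hli := linearIndependent_of_top_le_span_of_card_eq_finrank hspan.ge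
      (by simpa using hrank.symm)
    simp only [germ_iterate_alongProd] at hli
    rw [hflag q e he, hflag q e he, hflag q e he, N.grBijective_iff (hbij q)]
    exact ⟨fun v hv hv' => cyclicFlag_gr_injective (N.along_smul _) hli (hi.trans hr) hv hv',
      fun x hx => cyclicFlag_gr_surjective (N.along_smul _) _ hx⟩

/-- A partial oper is determined by its line. -/
theorem IsPartialOper.ext_line [Module.Finite R Ω[R⁄k]] [Module.Projective R Ω[R⁄k]]
    (hX : ∀ x : PrimeSpectrum R, Module.rankAtStalk Ω[R⁄k] x = 1) {N : Connection k R M} {r : ℕ}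
    (hr : 1 ≤ r) {U : Opens (PrimeSpectrum (A ⊗[k] R))} {F G : Fin (r + 1) → Family M U}
    (hF : IsPartialOper N r F) (hG : IsPartialOper N r G)
    (h : F ⟨1, by omega⟩ = G ⟨1, by omega⟩) : F = G := by
  have hbot : ∀ {F : Fin (r + 1) → Family M U}, IsPartialOper N r F → ∀ q,
      F ⟨0, by omega⟩ q = ⊥ := by
    intro F hF q
    obtain ⟨_, _, hFq⟩ := (hF.isSubbundle ⟨0, by omega⟩).isFramed q
    simpa using hFq
  -- Each `x` in `F_{i+2}` is a derivative of some `v` in `F_{i+1}` up to an element of `F_{i+1}`.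
  -- When `F_{i+1} = G_{i+1}`, both terms lie in `G_{i+2}`. Any generator of `ω` at the stalk serves
  -- for the differentiation.
  have step : ∀ {F G : Fin (r + 1) → Family M U}, IsPartialOper N r F → IsPartialOper N r G →
      ∀ (i : ℕ) (hi : i + 2 ≤ r) (q : U), F ⟨i + 1, by omega⟩ q = G ⟨i + 1, by omega⟩ q →
        F ⟨i + 2, by omega⟩ q ≤ G ⟨i + 2, by omega⟩ q := by
    intro F G hF hG i hi q heq x hx
    obtain ⟨ε⟩ := nonempty_equiv_kaehler hX (isBaseChange_kaehler_stalk q.1)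
    have hbij : Function.Bijective ε.symm.toLinearMap := ε.symm.bijective
    obtain ⟨v, hv, hxv⟩ := ((N.grBijective_iff hbij).1 (hF.grBijective i hi q)).2 x hx
    rw [heq] at hv hxv
    have h1 := (N.mapsInto_iff hbij).1 (hG.mapsInto (i + 1) hi q) v hv
    simpa using add_mem (hG.le (i + 1) hi q hxv) h1
  have key : ∀ (i : ℕ) (hi : i + 1 < r + 1) (q : U), F ⟨i + 1, hi⟩ q = G ⟨i + 1, hi⟩ q := by
    intro i
    induction i with
    | zero => exact fun hi q => congrFun h q
    | succ i ih =>
      exact fun hi q => le_antisymm (step hF hG i (by omega) q (ih (by omega) q))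
        (step hG hF i (by omega) q (ih (by omega) q).symm)
  funext ⟨i, hi⟩ q
  cases i with
  | zero => exact (hbot hF q).trans (hbot hG q).symm
  | succ i => exact key i hi q

variable [IsDomain R]

/-- The map from the local ring at the generic point of the fibre over `s` to its residue field,
the function field of `X`. -/
def fibreStalkHom (s : A →ₐ[k] k) : Stalk (fibreGenericPoint R s) →ₐ[R] FractionRing R :=
  IsLocalization.liftAlgHom (M := (fibreGenericPoint R s).asIdeal.primeCompl)
    (f := (IsScalarTower.toAlgHom R R (FractionRing R)).comp (fibreHom R s)) fun y =>
      isUnit_iff_ne_zero.2 fun h => y.2 ((mem_fibreGenericPoint s _).2 (by simpa using h))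

theorem fibreStalkHom_algebraMap (s : A →ₐ[k] k) (x : A ⊗[k] R) :
    fibreStalkHom s (algebraMap (A ⊗[k] R) (Stalk (fibreGenericPoint R s)) x) =
      algebraMap R (FractionRing R) (fibreHom R s x) :=
  IsLocalization.lift_eq _ x

/-- Functions on `S` become constants on the fibre, so differentiation relative to `A` restricts to
differentiation relative to `k`: the compatibility that `eMap_iterate_along` requires. -/
theorem fibreStalkHom_algebraMap_base (s : A →ₐ[k] k) (a : A) :
    fibreStalkHom s (algebraMap A (Stalk (fibreGenericPoint R s)) a) =
      algebraMap k (FractionRing R) (s a) := by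
  rw [IsScalarTower.algebraMap_apply A (A ⊗[k] R) (Stalk (fibreGenericPoint R s)),
    fibreStalkHom_algebraMap, fibreHom_algebraMap, ← IsScalarTower.algebraMap_apply]

/-- A germ in the maximal ideal is a fraction whose numerator vanishes on the fibre. This is the
hypothesis needed to lift frames from the function field. -/
theorem fibreStalkHom_eq_zero (s : A →ₐ[k] k) (f : Stalk (fibreGenericPoint R s))
    (hf : f ∈ IsLocalRing.maximalIdeal (Stalk (fibreGenericPoint R s))) :
    fibreStalkHom s f = 0 := by
  obtain ⟨⟨b, t⟩, hbt⟩ :=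
    IsLocalization.surj (fibreGenericPoint R s).asIdeal.primeCompl f
  have hb : algebraMap (A ⊗[k] R) (Stalk (fibreGenericPoint R s)) b ∈
      IsLocalRing.maximalIdeal (Stalk (fibreGenericPoint R s)) :=
    hbt ▸ Ideal.mul_mem_right _ _ hf
  rw [IsLocalization.AtPrime.to_map_mem_maximal_iff _ (fibreGenericPoint R s).asIdeal,
    mem_fibreGenericPoint] at hb
  have h := congrArg (fibreStalkHom s) hbt
  rw [map_mul, fibreStalkHom_algebraMap, fibreStalkHom_algebraMap, hb, map_zero] at h
  refine (mul_eq_zero.1 h).resolve_right fun h' => t.2 ?_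
  exact (mem_fibreGenericPoint s _).2 (by simpa using h')

variable [IsAlgClosed k] [Algebra.FiniteType k R] [Module.Finite R M]
  [Module.Projective R Ω[R⁄k]]

/-- A nowhere vanishing germ at the generic point of a closed fibre is a cyclic vector. -/
theorem span_iterate_alongStalk_eq_top
    (hX : ∀ x : PrimeSpectrum R, Module.rankAtStalk Ω[R⁄k] x = 1) {N : Connection k R M}
    (hN : N.IsIrreducible) {θ : Ω[R⁄k] →ₗ[R] R} (hθ : Function.Injective θ) (s : A →ₐ[k] k)
    {ι : Type*} [Fintype ι]
    (b : Module.Basis ι (Stalk (fibreGenericPoint R s)) (EStalk M (fibreGenericPoint R s)))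
    (i : ι) :
    Submodule.span (Stalk (fibreGenericPoint R s)) (Set.range fun j : Fin (Fintype.card ι) =>
      (N.alongStalk θ (fibreGenericPoint R s))^[j] (b i)) = ⊤ := by
  have : Algebra.FormallyEtale R (FractionRing R) :=
    Algebra.FormallyEtale.of_isLocalization (nonZeroDivisors R)
  have hK := KaehlerDifferential.isBaseChange_of_formallyEtale k R (FractionRing R)
  -- It suffices to generate over the function field. A member of a basis stays nonzero there, hence
  -- is cyclic by irreducibility.
  refine span_eq_top_of_span_eMap_eq_top (fibreStalkHom s) (fibreStalkHom_eq_zero s)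
    (b.reindex (Fintype.equivFin ι)) _ ?_
  obtain ⟨b', hb'⟩ := isBasis_eMap (fibreStalkHom s) b
  have h := cyclicFlag_eq_top (N.along_smul (liftForm hK θ))
    (hN.eq_bot_or_eq_top hX hK hθ) (b'.ne_zero i)
  rw [Module.finrank_eq_card_basis b', cyclicFlag, hb'] at h
  rw [← h]
  congr 2
  funext j
  exact eMap_iterate_along s (fibreStalkHom s) (fibreStalkHom_algebraMap_base s) N _ hK θ j (b i)

variable [Module.Projective R M]

/-- Near the generic point of a closed fibre, a line is generated by a cyclic section. -/
theorem IsSubbundle.exists_cyclic_section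
    (hX : ∀ x : PrimeSpectrum R, Module.rankAtStalk Ω[R⁄k] x = 1) {n : ℕ}
    (hn : ∀ x : PrimeSpectrum R, Module.rankAtStalk M x = n) {N : Connection k R M}
    (hN : N.IsIrreducible) {θ : Ω[R⁄k] →ₗ[R] R} (hθ : Function.Injective θ)
    {U : Opens (PrimeSpectrum (A ⊗[k] R))} {F : Family M U} (hF : IsSubbundle 1 F)
    (s : A →ₐ[k] k) (hs : fibreGenericPoint R s ∈ U) :
    ∃ W : Opens (PrimeSpectrum (A ⊗[k] R)), fibreGenericPoint R s ∈ W ∧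
      ∃ e : (A ⊗[k] R) ⊗[R] M, ∀ q : U, q.1 ∈ W →
        F q = Submodule.span (Stalk q.1) {germ q.1 e} ∧
        Submodule.span (Stalk q.1)
          (Set.range fun j : Fin n => germ q.1 ((N.alongProd A θ)^[j] e)) = ⊤ := by
  obtain ⟨W, hW, j, a, c, H⟩ := hF ⟨_, hs⟩
  obtain ⟨⟨b, hb⟩, -⟩ := H ⟨_, hs⟩ hW
  have hcard : Fintype.card (Fin 1 ⊕ Fin j) = n := by
    rw [← Module.finrank_eq_card_basis b, (finrank_eStalk hn _).2]
  have hspan := span_iterate_alongStalk_eq_top hX hN hθ s b (Sum.inl 0)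
  rw [hcard, hb] at hspan
  simp only [Sum.elim_inl, ← germ_iterate_alongProd] at hspan
  -- The generator `a 0` is part of a frame, so it is cyclic at the fibre's generic point; the
  -- derivatives, being global sections, remain generating nearby.
  obtain ⟨W', hW', H'⟩ := exists_open_span_germ_eq_top _ _ hspan
  refine ⟨W ⊓ W', ⟨hW, hW'⟩, a 0, fun q hq => ⟨?_, H' q.1 hq.2⟩⟩
  rw [(H q hq.1).2, Set.range_unique]
  rfl

/-! ### The isomorphisms of presheaves. -/

open CategoryTheory

/-- Generic partial opers correspond to generic lines. -/
theorem isIso_firstLine (hX : ∀ x : PrimeSpectrum R, Module.rankAtStalk Ω[R⁄k] x = 1) {n : ℕ}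
    (hn : ∀ x : PrimeSpectrum R, Module.rankAtStalk M x = n) {N : Connection k R M}
    (hN : N.IsIrreducible) {r : ℕ} (hr : 1 ≤ r) (hrn : r ≤ n) : IsIso (firstLine N hr) := by
  rw [NatTrans.isIso_iff_isIso_app]
  intro A
  rw [isIso_iff_bijective]
  have hfg : Algebra.FiniteType k A.obj := A.2
  constructor
  · intro x y
    induction x using Quot.ind with | mk x
    induction y using Quot.ind with | mk y
    intro hxy
    -- Injectivity: the two lines agree on some sub-domain, and there they determine the flags.
    obtain ⟨V, hx, hy, H⟩ := ((FamilyCondition.Sect.Rel.equivalence _).quot_mk_eq_iff _ _).1 hxy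
    refine Quot.sound ⟨V, hx, hy, fun i => ?_⟩
    exact congrFun (IsPartialOper.ext_line hX hr (IsPartialOper.res hx x.holds)
      (IsPartialOper.res hy y.holds) (H ())) i
  · intro y
    induction y using Quot.ind with | mk y
    obtain ⟨θ, w, hw, hθ⟩ := exists_form_injective (k := k) hX
    let good : Set (Opens (PrimeSpectrum (A.obj ⊗[k] R))) := {W |
      ∃ e : (A.obj ⊗[k] R) ⊗[R] M, ∀ q : y.dom.carrier, q.1 ∈ W →
        y.fam () q = Submodule.span (Stalk q.1) {germ q.1 e} ∧
        Submodule.span (Stalk q.1)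
          (Set.range fun j : Fin n => germ q.1 ((N.alongProd A.obj θ)^[j] e)) = ⊤}
    -- The part of the given domain where the vector field does not vanish and the line has local
    -- cyclic generators. It contains each fibre's generic point, since `θ w` restricts to itself, a
    -- nonzero function, on every closed fibre.
    let V : Dom k R A.obj := Dom.ofFibreGenericPoint (y.dom.carrier ⊓
        PrimeSpectrum.basicOpen (algebraMap R (A.obj ⊗[k] R) (θ w)) ⊓ sSup good) fun s => by
      have hs := y.dom.fibreGenericPoint_mem s
      refine ⟨⟨hs, ?_⟩, ?_⟩
      · change _ ∉ (fibreGenericPoint R s).asIdeal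
        rw [mem_fibreGenericPoint, AlgHom.commutes]
        exact hw
      · obtain ⟨W, hW, he⟩ := IsSubbundle.exists_cyclic_section hX hn hN hθ y.holds s hs
        exact Opens.mem_sSup.2 ⟨W, he, hW⟩
    have hVU : V.carrier ≤ y.dom.carrier := fun q hq => hq.1.1
    have hoper := isPartialOper_derivedFlag hX hn N θ w hrn (F := (y.fam ()).res hVU)
      (fun q => q.2.1.2) fun p => by
        obtain ⟨W, ⟨e, he⟩, hW⟩ := Opens.mem_sSup.1 p.2.2
        exact ⟨W, hW, e, fun q hq => he ⟨q.1, hVU q.2⟩ hq⟩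
    refine ⟨Quot.mk _ ⟨V, _, hoper⟩, Quot.sound ⟨V, le_rfl, hVU, fun i => funext fun q => ?_⟩⟩
    -- Only derivatives of order zero enter `F_1`, so the flag starts with the given line.
    exact derivedFlag_one _

end Geometry

end GenericOper

end

theorem lemmal {k R M : Type u} [Field k] [IsAlgClosed k] [CharZero k]
    [CommRing R] [IsDomain R] [Algebra k R] [Algebra.Smooth k R]
    (hX : ∀ x : PrimeSpectrum R, Module.rankAtStalk Ω[R⁄k] x = 1)
    [AddCommGroup M] [Module R M] [Module.Finite R M] [Module.Projective R M]
    (n : ℕ) (hn : ∀ x : PrimeSpectrum R, Module.rankAtStalk M x = n)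
    (N : GenericOper.Connection k R M) (hN : N.IsIrreducible) :
    (∀ r : ℕ, 2 ≤ r → r ≤ n - 1 →
      CategoryTheory.IsIso (GenericOper.forgetOper N (Nat.sub_le r 1))) ∧
    (∀ (r : ℕ) (hr : 1 ≤ r), r ≤ n →
      CategoryTheory.IsIso (GenericOper.firstLine N hr)) := by
  refine ⟨fun r hr hrn => ?_, fun r hr hrn => GenericOper.isIso_firstLine hX hn hN hr hrn⟩
  -- Taking the first line of a flag factors through forgetting `F_r`; both maps to lines are
  -- isomorphisms, hence so is the forgetful map.
  have h₁ := GenericOper.isIso_firstLine hX hn hN (show 1 ≤ r - 1 by omega) (by omega)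
  have h₂ := GenericOper.isIso_firstLine hX hn hN (show 1 ≤ r by omega) (by omega)
  have hcomp : CategoryTheory.CategoryStruct.comp (GenericOper.forgetOper N (Nat.sub_le r 1))
      (GenericOper.firstLine N (show 1 ≤ r - 1 by omega)) =
      GenericOper.firstLine N (show 1 ≤ r by omega) := by
    ext A x
    induction x using Quot.ind with
    | mk x => rfl
  rw [← hcomp] at h₂
  exact CategoryTheory.IsIso.of_isIso_comp_right _
    (GenericOper.firstLine N (show 1 ≤ r - 1 by omega))
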